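/- Let $\|\cdot\|$ be a norm on $\mathbb R^d$, let $G\in\mathbb R^{d\times d}$ be a matrix (not necessarily diagonalizable) all of whose complex eigenvalues have positive real part, and let $(\eta_t)_{t\ge 0}$ be step sizes such that: (i) $0<\eta_t\le 1$, $\eta_t$ is non-increasing with $\eta_t\to 0$, $\eta_t\log^2 t\to 0$, and $t\eta_t$ is non-decreasing with $t\eta_t\to\infty$; (ii) $(\eta_{t-1}-\eta_t)/\eta_{t-1}=o(\eta_{t-1})$; (iii) $\sum_{t\ge 1}\frac{\log t}{\sqrt t}\,\eta_t<\infty$; (iv) there is a constant $c$ with $\frac{\sum_{t=0}^T\eta_t}{T\eta_T}\le c$ for all $T\ge 1$. Let $(\varepsilon_t)_{t\ge 0}$ be an $\mathbb R^d$-valued martingale difference sequence with respect to a filtration $(\mathcal F_t)_{t\ge0}$ on a probability space, that is, $\varepsilon_t$ is integrable and $\mathcal F_t$-measurable and $\mathbb E[\varepsilon_{t+1}\mid\mathcal F_t]=0$ for all $t\ge 0$. Suppose that $\sup_{t\ge 0}\mathbb E\|\varepsilon_t\|^p<\infty$ for some $p>2$. Define $y_0=0$ and $y_{t+1}=(I-\eta_tG)y_t+\eta_t\varepsilon_t$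 for $t\ge 0$, and for $T\ge 1$ $$\bar y_T(r)=\frac{y_{\lfloor (T+1)r\rfloor}}{\sqrt T\,\eta_{\lfloor (T+1)r\rfloor}}\quad (r\in[0,1]),\qquad |||\bar y_T|||=\sup_{r\in[0,1]}\|\bar y_T(r)\|.$$ Then: 1. $y_{t+1}=\sum_{j=0}^t\Big(\prod_{i=j+1}^t(I-\eta_iG)\Big)\eta_j\varepsilon_j$ for all $t\ge 0$, and $|||\bar y_T|||\to 0$ in probability as $T\to\infty$. 2. If moreover $\eta_t=t^{-\alpha}$ for all $t\ge 1$, with $\alpha\in(1/2,1)$, then for all $p'\in[2,p]$ and all $T\ge 1$ $$\widetilde d(\bar y_T):=\inf_{\delta\ge 0}\ \max\big\{\delta,\ \mathbb P(|||\bar y_T|||\ge\delta)\big\}\ \le\ C\,p'\,T^{-(1-\alpha)\frac{p'-2}{2(p'+1)}},$$ where the constant $C$ depends only on $d$, $\|\cdot\|$, $G$, the step sizes, and an upper bound $M$ on $\sup_{t\ge0}(\mathbb E\|\varepsilon_t\|^p)^{1/p}$; in particular it does not depend on $T$, on $p'$, or otherwise on $p$ or on the law of $(\varepsilon_t)$.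 -/

import Mathlib

open MeasureTheory ProbabilityTheory Filter Topology Asymptotics
open scoped ENNReal NNReal

noncomputable section

/-- Slowly decaying step sizes `η 0, η 1, …`. -/
structure SlowStepSize (η : ℕ → ℝ) : Prop where
  pos : ∀ t, 0 < η t
  le_one : ∀ t, η t ≤ 1
  antitone : Antitone η
  tendsto_zero : Tendsto η atTop (𝓝 0)
  mul_log_sq : Tendsto (fun t : ℕ => η t * Real.log t ^ 2) atTop (𝓝 0)
  mul_monotone : Monotone (fun t : ℕ => (t : ℝ) * η t)
  mul_tendsto : Tendsto (fun t : ℕ => (t : ℝ) * η t) atTop atTop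
  diff_littleO : (fun t : ℕ => (η t - η (t + 1)) / η t) =o[atTop] η
  summable_log : Summable (fun t : ℕ => Real.log t / Real.sqrt t * η t)
  sum_le : ∃ C : ℝ, ∀ T : ℕ, 1 ≤ T → (∑ t ∈ Finset.range (T + 1), η t) / (T * η T) ≤ C

/-- Every complex eigenvalue of the real matrix `G` has positive real part
(that is, `-G` is a Hurwitz matrix). -/
def PosRealPartEigenvalues {d : ℕ} (G : Matrix (Fin d) (Fin d) ℝ) : Prop :=
  ∀ z : ℂ, Module.End.HasEigenvalue (Matrix.toLin' (G.map Complex.ofReal)) z → 0 < z.re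

section

variable {Ω : Type*} {d : ℕ}

/-- `ε` is a martingale difference sequence with respect to `ℱ`: adapted, integrable, and
`E[ε (t+1) | ℱ t] = 0` almost surely. -/
structure IsMartingaleDifference {mΩ : MeasurableSpace Ω} (μ : Measure Ω) (ℱ : Filtration ℕ mΩ)
    (ε : ℕ → Ω → Fin d → ℝ) : Prop where
  adapted : ∀ t, StronglyMeasurable[ℱ t] (ε t)
  integrable : ∀ t, Integrable (ε t) μ
  condExp_eq_zero : ∀ t, μ[ε (t + 1) | ℱ t] =ᵐ[μ] 0

/-- The `p`-th moment `E ‖X‖ ^ p`, for the norm `N`, as an extended nonnegative real. -/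
def normMoment {mΩ : MeasurableSpace Ω} (μ : Measure Ω) (N : Seminorm ℝ (Fin d → ℝ)) (p : ℝ)
    (X : Ω → Fin d → ℝ) : ℝ≥0∞ :=
  ∫⁻ ω, ENNReal.ofReal (N (X ω)) ^ p ∂μ

/-- `y 0 = 0` and `y (t+1) = (I - η t G) y t + η t ε t`. -/
def ySeq (G : Matrix (Fin d) (Fin d) ℝ) (η : ℕ → ℝ) (ε : ℕ → Ω → Fin d → ℝ) :
    ℕ → Ω → Fin d → ℝ
  | 0, _ => 0
  | t + 1, ω => (1 - η t • G).mulVec (ySeq G η ε t ω) + η t • ε t ω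

/-- The product of the (commuting) matrices `I - η i G` over `j + 1 ≤ i ≤ t`, where `j ≤ t`;
it is the identity for `j = t`. -/
def stepProd (G : Matrix (Fin d) (Fin d) ℝ) (η : ℕ → ℝ) (j t : ℕ) : Matrix (Fin d) (Fin d) ℝ :=
  ((List.range' (j + 1) (t - j)).map fun i => 1 - η i • G).prod

/-- The normalized process `r ↦ y_{⌊(T+1)r⌋} / (√T η_{⌊(T+1)r⌋})`. -/
def yBar (G : Matrix (Fin d) (Fin d) ℝ) (η : ℕ → ℝ) (ε : ℕ → Ω → Fin d → ℝ) (T : ℕ) (r : ℝ)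
    (ω : Ω) : Fin d → ℝ :=
  (Real.sqrt T * η ⌊((T : ℝ) + 1) * r⌋₊)⁻¹ • ySeq G η ε ⌊((T : ℝ) + 1) * r⌋₊ ω

/-- The uniform norm over `r ∈ [0,1]` of `yBar` (the supremum is over finitely many values). -/
def yBarSup (N : Seminorm ℝ (Fin d → ℝ)) (G : Matrix (Fin d) (Fin d) ℝ) (η : ℕ → ℝ)
    (ε : ℕ → Ω → Fin d → ℝ) (T : ℕ) (ω : Ω) : ℝ :=
  ⨆ r : Set.Icc (0 : ℝ) 1, N (yBar G η ε T r ω)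

/-- The Ky-Fan-type functional `inf_{δ ≥ 0} max(δ, P(X ≥ δ))`. -/
def kyFan {mΩ : MeasurableSpace Ω} (μ : Measure Ω) (X : Ω → ℝ) : ℝ :=
  ⨅ δ : Set.Ici (0 : ℝ), max (δ : ℝ) (μ.real {ω | (δ : ℝ) ≤ X ω})

end

end

/-! Since the eigenvalues of `G` lie in the right half plane, there is a Hilbert norm, equivalent to
the given one, in which `I - sG` contracts by `1 - c s` for all small `s`
(`exists_lyapunov_embedding`). In that norm `y` is a contraction plus a conditionally centred
increment of size `η t`.

The second order expansion of `‖·‖ ^ p` has a linear term that the martingale property kills, even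
on events of the past. What remains, with Hölder, says that squared `L^p` norms add up to a factor
of order `p ^ 2` (`integral_norm_add_rpow_le`). Contraction by `1 - c η t` against noise of squared
size `η t ^ 2` balances at `E ‖y t‖ ^ p ≤ (p ^ 2 K η t) ^ (p / 2)`.

A union bound over time would lose too much. Instead, a Hájek–Rényi argument is applied to `‖y t‖ ^
p / (l η t) ^ p` with `l` of order `δ √T`. Because `η` decays more slowly than the dynamics
contract, `ρ t * η t ≤ η (t + 1)`, the change of weight is absorbed by the contraction and each step
adds only a drift of order `η t (p ^ 2 / (δ ^ 2 T η T)) ^ (p / 2)`. As `∑ η t` is at most of order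
`T η T`, this yields `P(sup ≥ δ) ≤ (A p / δ) ^ p (T η T) ^ (1 - p / 2)` (`exists_tail_bound`).
Convergence in probability follows from `T η T → ∞`, and the rate from balancing `δ` with the tail.
-/

/-! ### Hurwitz stability: powers of an Euler step contract -/

section Lyapunov

variable {d : ℕ}

/-- A small explicit Euler step moves a finite subset of the open right half plane, mapped by
`z ↦ 1 - h z`, into the open unit disc. -/
theorem exists_norm_one_sub_mul_lt_one {S : Set ℂ} (hS : S.Finite) (hpos : ∀ z ∈ S, 0 < z.re) :
    ∃ h : ℝ, 0 < h ∧ ∀ z ∈ S, ‖1 - (h : ℂ) * z‖ < 1 := by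
  have key : ∀ z ∈ S, ∀ᶠ h : ℝ in 𝓝[>] 0, ‖1 - (h : ℂ) * z‖ < 1 := by
    intro z hz
    -- `|1 - h z| ^ 2 = 1 - 2 h Re z + h ^ 2 |z| ^ 2`, so the condition is `h |z| ^ 2 < 2 Re z`.
    have h1 : Tendsto (fun h : ℝ => h * Complex.normSq z) (𝓝[>] 0) (𝓝 0) := by
      have : Continuous fun h : ℝ => h * Complex.normSq z := by fun_prop
      simpa using (this.tendsto 0).mono_left nhdsWithin_le_nhds
    filter_upwards [h1.eventually_lt_const (show (0 : ℝ) < 2 * z.re by linarith [hpos z hz]),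
      self_mem_nhdsWithin] with h hh (hh0 : 0 < h)
    have h2 : ‖1 - (h : ℂ) * z‖ ^ 2 < 1 := by
      rw [← Complex.normSq_eq_norm_sq]
      simp only [Complex.normSq_apply] at hh ⊢
      simp
      nlinarith
    nlinarith [norm_nonneg (1 - (h : ℂ) * z)]
  have := (hS.eventually_all).2 key
  obtain ⟨h, hh, hh0⟩ := (this.and self_mem_nhdsWithin).exists
  exact ⟨h, hh0, hh⟩

open scoped Matrix.Norms.L2Operator in
/-- For a matrix with eigenvalues in the open right half plane, some power of a small explicit
Euler step is a strict contraction of the Euclidean norm. -/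
theorem exists_pow_contraction (G : Matrix (Fin d) (Fin d) ℝ) (hG : PosRealPartEigenvalues G) :
    ∃ h : ℝ, 0 < h ∧ ∃ n : ℕ, 1 ≤ n ∧ ∃ ρ : ℝ, ρ < 1 ∧ 0 ≤ ρ ∧ ∀ x : Fin d → ℝ,
      ‖WithLp.toLp 2 (((1 - h • G) ^ n).mulVec x)‖ ≤ ρ * ‖WithLp.toLp 2 x‖ := by
  set Gc : Matrix (Fin d) (Fin d) ℂ := G.map Complex.ofReal with hGc
  have hspec : ∀ z ∈ spectrum ℂ Gc, 0 < z.re := by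
    intro z hz
    rw [← Matrix.spectrum_toLin', ← Module.End.hasEigenvalue_iff_mem_spectrum] at hz
    exact hG z hz
  obtain ⟨h, h0, hh⟩ := exists_norm_one_sub_mul_lt_one (Matrix.finite_spectrum Gc) hspec
  set A : Matrix (Fin d) (Fin d) ℂ := 1 - (h : ℂ) • Gc with hA
  have hAspec : ∀ z ∈ spectrum ℂ A, ‖z‖ < 1 := by
    intro z hz
    have hne : (h : ℂ) ≠ 0 := by exact_mod_cast h0.ne'
    have h2 : (1 - z) / h ∈ spectrum ℂ Gc := by
      rw [← Matrix.spectrum_toLin', ← Module.End.hasEigenvalue_iff_mem_spectrum] at hz ⊢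
      obtain ⟨v, hv⟩ := hz.exists_hasEigenvector
      refine Module.End.hasEigenvalue_of_hasEigenvector (x := v) ⟨?_, hv.2⟩
      have := hv.apply_eq_smul
      rw [Module.End.mem_eigenspace_iff]
      simp only [hA, Matrix.toLin'_apply, Matrix.sub_mulVec, Matrix.one_mulVec,
        Matrix.smul_mulVec] at this ⊢
      rw [div_eq_inv_mul, mul_smul, eq_inv_smul_iff₀ hne, sub_smul, one_smul, ← this]
      abel
    have := hh _ h2
    rwa [mul_div_cancel₀ _ hne, sub_sub_cancel] at this
  have hrad : spectralRadius ℂ A < 1 := by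
    -- The spectrum is empty only when `d = 0`.
    rcases (spectrum ℂ A).eq_empty_or_nonempty with he | hne
    · simp [spectralRadius, he]
    · exact_mod_cast spectrum.spectralRadius_lt_of_forall_lt_of_nonempty hne (r := 1)
        fun z hz => by exact_mod_cast hAspec z hz
  -- Gelfand's formula turns spectral radius below one into a power of norm below one.
  have hlim := spectrum.pow_norm_pow_one_div_tendsto_nhds_spectralRadius A
  obtain ⟨n, hn, hn1⟩ := ((hlim.eventually_lt_const hrad).and (eventually_ge_atTop 1)).exists
  have hpow : ‖A ^ n‖ < 1 := by
    by_contra! hc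
    have : (1 : ℝ) ≤ ‖A ^ n‖ ^ (1 / n : ℝ) := Real.one_le_rpow hc (by positivity)
    rw [← ENNReal.ofReal_one, ENNReal.ofReal_lt_ofReal_iff_of_nonneg (by positivity)] at hn
    linarith
  refine ⟨h, h0, n, hn1, ‖A ^ n‖, hpow, norm_nonneg _, fun x => ?_⟩
  have hmap : A ^ n = ((1 - h • G) ^ n).map (Complex.ofRealHom : ℝ →+* ℂ) := by
    rw [Matrix.map_pow]
    congr 1
    ext i j
    simp [hA, hGc, Matrix.one_apply]
    split_ifs <;> simp
  have hvec : (A ^ n).mulVec (fun i => (x i : ℂ)) =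
      fun i => ((((1 - h • G) ^ n).mulVec x i : ℝ) : ℂ) := by
    rw [hmap]
    ext i
    exact (RingHom.map_mulVec Complex.ofRealHom _ x i).symm
  have hnorm : ∀ v : Fin d → ℝ, ‖WithLp.toLp 2 (fun i => (v i : ℂ))‖ = ‖WithLp.toLp 2 v‖ := by
    intro v
    simp [EuclideanSpace.norm_eq]
  have := Matrix.l2_opNorm_mulVec (A ^ n) (WithLp.toLp 2 (fun i => (x i : ℂ)))
  rw [hnorm] at this
  rw [← hnorm, ← hvec]
  exact this

end Lyapunov

/-! ### The adapted Hilbert norm and equivalence of norms -/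

section Embedding

variable {d : ℕ}

/-- The Hilbert space embedding `x ↦ (x, A x, …, A ^ (n - 1) x)`. -/
noncomputable def powEmbedding (A : Matrix (Fin d) (Fin d) ℝ) (n : ℕ) :
    (Fin d → ℝ) →ₗ[ℝ] EuclideanSpace ℝ (Fin n × Fin d) where
  toFun x := WithLp.toLp 2 fun k => ((A ^ (k.1 : ℕ)).mulVec x) k.2
  map_add' x y := by ext k; simp [Matrix.mulVec_add]
  map_smul' a x := by ext k; simp [Matrix.mulVec_smul]

theorem norm_sq_powEmbedding (A : Matrix (Fin d) (Fin d) ℝ) (n : ℕ) (x : Fin d → ℝ) :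
    ‖powEmbedding A n x‖ ^ 2 =
      ∑ k ∈ Finset.range n, ‖WithLp.toLp 2 ((A ^ k).mulVec x)‖ ^ 2 := by
  simp only [EuclideanSpace.norm_sq_eq, powEmbedding, LinearMap.coe_mk, AddHom.coe_mk]
  rw [Fintype.sum_prod_type, Finset.sum_range]

/-- Applying `A` shifts the orbit by one, so the sums of squares telescope. -/
theorem powEmbedding_mulVec_sq (A : Matrix (Fin d) (Fin d) ℝ) (n : ℕ) (x : Fin d → ℝ) :
    ‖powEmbedding A n (A.mulVec x)‖ ^ 2 + ‖WithLp.toLp 2 x‖ ^ 2 =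
      ‖powEmbedding A n x‖ ^ 2 + ‖WithLp.toLp 2 ((A ^ n).mulVec x)‖ ^ 2 := by
  have h : ∀ k, (A ^ k).mulVec (A.mulVec x) = (A ^ (k + 1)).mulVec x := fun k => by
    rw [Matrix.mulVec_mulVec, pow_succ]
  rw [norm_sq_powEmbedding, norm_sq_powEmbedding, ← Finset.sum_range_succ,
    Finset.sum_range_succ']
  simp [h]

/-- If `A ^ n` contracts, the telescoping identity makes `A = 1 - h G` itself a strict contraction
for the orbit norm. Every smaller step is a convex combination of `1` and `A`, so its contraction is
linear in `s`. The constant `R` only serves the finitely many initial steps with `η t > h`. -/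
theorem exists_lyapunov_embedding (G : Matrix (Fin d) (Fin d) ℝ)
    (hG : PosRealPartEigenvalues G) :
    ∃ (n : ℕ) (Φ : (Fin d → ℝ) →ₗ[ℝ] EuclideanSpace ℝ (Fin n × Fin d)),
      Function.Injective Φ ∧ ∃ c : ℝ, 0 < c ∧ ∃ h : ℝ, 0 < h ∧ ∃ R : ℝ, 1 ≤ R ∧
        (∀ s : ℝ, 0 ≤ s → s ≤ h → ∀ x, ‖Φ ((1 - s • G).mulVec x)‖ ≤ (1 - c * s) * ‖Φ x‖) ∧
        (∀ s : ℝ, 0 ≤ s → s ≤ 1 → ∀ x, ‖Φ ((1 - s • G).mulVec x)‖ ≤ R * ‖Φ x‖) := by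
  obtain ⟨h, h0, n, hn, ρ, hρ1, hρ0, hρ⟩ := exists_pow_contraction G hG
  set A := 1 - h • G with hA
  set Φ := powEmbedding A n with hΦ
  obtain ⟨C, hC0, hC⟩ : ∃ C : ℝ, 0 < C ∧ ∀ x, ‖Φ x‖ ≤ C * ‖WithLp.toLp 2 x‖ := by
    let L := (Φ ∘ₗ (WithLp.linearEquiv 2 ℝ (Fin d → ℝ)).toLinearMap :
      EuclideanSpace ℝ (Fin d) →ₗ[ℝ] _).toContinuousLinearMap
    obtain ⟨C, hC0, hC⟩ := L.bound
    exact ⟨C, hC0, fun x => hC (WithLp.toLp 2 x)⟩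
  have hinj : Function.Injective Φ := by
    intro x y hxy
    ext i
    have := congrArg (fun v : EuclideanSpace ℝ (Fin n × Fin d) => v (⟨0, hn⟩, i)) hxy
    simpa [hΦ, powEmbedding] using this
  set κ : ℝ := (1 - ρ ^ 2) / C ^ 2 with hκ
  have hκ0 : 0 < κ := div_pos (by nlinarith) (by positivity)
  have hcontr : ∀ x, ‖Φ (A.mulVec x)‖ ^ 2 ≤ (1 - κ) * ‖Φ x‖ ^ 2 := by
    intro x
    have h1 := powEmbedding_mulVec_sq A n x
    have h2 : ‖WithLp.toLp 2 ((A ^ n).mulVec x)‖ ^ 2 ≤ ρ ^ 2 * ‖WithLp.toLp 2 x‖ ^ 2 := by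
      rw [← mul_pow]
      exact pow_le_pow_left₀ (norm_nonneg _) (hρ x) 2
    have h3 : κ * ‖Φ x‖ ^ 2 ≤ (1 - ρ ^ 2) * ‖WithLp.toLp 2 x‖ ^ 2 := by
      have h4 : ‖Φ x‖ ^ 2 ≤ C ^ 2 * ‖WithLp.toLp 2 x‖ ^ 2 := by
        rw [← mul_pow]
        exact pow_le_pow_left₀ (norm_nonneg _) (hC x) 2
      calc κ * ‖Φ x‖ ^ 2 ≤ κ * (C ^ 2 * ‖WithLp.toLp 2 x‖ ^ 2) := by gcongr
        _ = _ := by rw [hκ]; field_simp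
    rw [← hΦ] at h1
    linarith
  -- `√(1 - κ) ≤ 1 - κ / 2`; the minimum with one keeps the right side nonnegative.
  have hcontr' : ∀ x, ‖Φ (A.mulVec x)‖ ≤ (1 - min κ 1 / 2) * ‖Φ x‖ := by
    intro x
    have hm0 : 0 < min κ 1 := lt_min hκ0 one_pos
    have hm1 : min κ 1 ≤ 1 := min_le_right _ _
    have hm2 : min κ 1 ≤ κ := min_le_left _ _
    refine abs_le_of_sq_le_sq' ?_ (by have := norm_nonneg (Φ x); nlinarith) |>.2
    refine (hcontr x).trans ?_
    rw [mul_pow]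
    gcongr
    nlinarith
  set c := min κ 1 / 2 / h with hc
  have hm0 : 0 < min κ 1 := lt_min hκ0 one_pos
  have hc0 : 0 < c := by positivity
  have hsplit : ∀ s x, Φ ((1 - s • G).mulVec x) =
      (1 - s / h) • Φ x + (s / h) • Φ (A.mulVec x) := by
    intro s x
    rw [← map_smul, ← map_smul, ← map_add]
    congr 1
    rw [hA]
    simp only [Matrix.sub_mulVec, Matrix.one_mulVec, Matrix.smul_mulVec, smul_sub, smul_smul,
      div_mul_cancel₀ _ h0.ne', sub_smul, one_smul]
    abel
  refine ⟨n, Φ, hinj, c, hc0, h, h0, 1 + 2 / h, by simp; positivity, ?_, ?_⟩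
  · intro s hs0 hsh x
    have h1 : 0 ≤ s / h := by positivity
    have h2 : s / h ≤ 1 := (div_le_one h0).2 hsh
    rw [hsplit]
    calc _ ≤ ‖(1 - s / h) • Φ x‖ + ‖(s / h) • Φ (A.mulVec x)‖ := norm_add_le _ _
      _ = (1 - s / h) * ‖Φ x‖ + (s / h) * ‖Φ (A.mulVec x)‖ := by
        rw [norm_smul, norm_smul, Real.norm_of_nonneg h1, Real.norm_of_nonneg (by linarith)]
      _ ≤ (1 - s / h) * ‖Φ x‖ + (s / h) * ((1 - min κ 1 / 2) * ‖Φ x‖) := by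
        gcongr; exact hcontr' x
      _ = (1 - c * s) * ‖Φ x‖ := by rw [hc]; field_simp; ring
  · intro s hs0 hs1 x
    have h1 : 0 ≤ s / h := by positivity
    have h3 : ‖Φ (A.mulVec x)‖ ≤ ‖Φ x‖ := (hcontr' x).trans
      (mul_le_of_le_one_left (norm_nonneg _) (by linarith))
    rw [hsplit]
    calc _ ≤ ‖(1 - s / h) • Φ x‖ + ‖(s / h) • Φ (A.mulVec x)‖ := norm_add_le _ _
      _ = |1 - s / h| * ‖Φ x‖ + (s / h) * ‖Φ (A.mulVec x)‖ := by
        rw [norm_smul, norm_smul, Real.norm_of_nonneg h1, Real.norm_eq_abs]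
      _ ≤ (1 + s / h) * ‖Φ x‖ + (s / h) * ‖Φ x‖ := by
        gcongr
        rw [abs_le]; constructor <;> linarith
      _ = (1 + 2 * (s / h)) * ‖Φ x‖ := by ring
      _ ≤ (1 + 2 * (1 / h)) * ‖Φ x‖ := by gcongr
      _ = _ := by ring

/-- A norm on `ℝ^d` is equivalent to the norm pulled back along an injective linear map. -/
theorem exists_norm_equiv (N : Seminorm ℝ (Fin d → ℝ)) (hN : ∀ v, N v = 0 → v = 0)
    {H : Type*} [NormedAddCommGroup H] [NormedSpace ℝ H] (Φ : (Fin d → ℝ) →ₗ[ℝ] H)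
    (hΦ : Function.Injective Φ) :
    ∃ C : ℝ, 1 ≤ C ∧ (∀ x, N x ≤ C * ‖Φ x‖) ∧ ∀ x, ‖Φ x‖ ≤ C * N x := by
  obtain ⟨C₁, hC₁0, hC₁⟩ : ∃ C : ℝ, 0 ≤ C ∧ ∀ x, N x ≤ C * ‖x‖ := by
    refine ⟨∑ i, N (Pi.single i 1), Finset.sum_nonneg fun i _ => apply_nonneg _ _, fun x => ?_⟩
    calc N x = N (∑ i, x i • Pi.single i (1 : ℝ)) := by rw [← pi_eq_sum_univ' x]
      _ ≤ ∑ i, N (x i • Pi.single i (1 : ℝ)) := by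
        exact Finset.le_sum_of_subadditive N (map_zero N).le (map_add_le_add N) _ _
      _ ≤ ∑ i, N (Pi.single i 1) * ‖x‖ := by
        refine Finset.sum_le_sum fun i _ => ?_
        rw [map_smul_eq_mul, mul_comm]
        gcongr
        exact norm_le_pi_norm x i
      _ = _ := by rw [Finset.sum_mul]
  have hcont : Continuous N := Seminorm.continuous_of_le (p := N) (
      q := (Real.toNNReal C₁) • normSeminorm ℝ _)
    (by
      change Continuous fun x : Fin d → ℝ => (Real.toNNReal C₁ : ℝ) * ‖x‖
      fun_prop) (fun x => by
      change N x ≤ (Real.toNNReal C₁ : ℝ) * ‖x‖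
      rw [Real.coe_toNNReal _ hC₁0]; exact hC₁ x)
  obtain ⟨C₂, hC₂0, hC₂⟩ : ∃ C : ℝ, 0 ≤ C ∧ ∀ x, ‖x‖ ≤ C * N x := by
    -- The sphere is empty when `d = 0`; otherwise `N` has a positive minimum on it by compactness.
    rcases (Metric.sphere (0 : Fin d → ℝ) 1).eq_empty_or_nonempty with he | hne
    · refine ⟨0, le_rfl, fun x => ?_⟩
      by_cases hx : x = 0
      · simp [hx]
      · have : ‖x‖⁻¹ • x ∈ Metric.sphere (0 : Fin d → ℝ) 1 := by
          simp [norm_smul, inv_mul_cancel₀ (norm_ne_zero_iff.2 hx)]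
        simp [he] at this
    · obtain ⟨x₀, hx₀, hmin⟩ := (isCompact_sphere (0 : Fin d → ℝ) 1).exists_isMinOn hne
        hcont.continuousOn
      have hpos : 0 < N x₀ := by
        refine lt_of_le_of_ne (apply_nonneg _ _) fun h => ?_
        have := hN x₀ h.symm
        simp [this] at hx₀
      refine ⟨(N x₀)⁻¹, by positivity, fun x => ?_⟩
      by_cases hx : x = 0
      · simp [hx]
      · have hx' : 0 < ‖x‖ := norm_pos_iff.2 hx
        have : N x₀ ≤ N (‖x‖⁻¹ • x) := hmin (by simp [norm_smul, inv_mul_cancel₀ hx'.ne'])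
        rw [map_smul_eq_mul, norm_inv, norm_norm, ← div_eq_inv_mul, le_div_iff₀ hx'] at this
        rw [← div_eq_inv_mul, le_div_iff₀ hpos]
        linarith
  obtain ⟨C₃, hC₃0, hC₃⟩ := Φ.toContinuousLinearMap.bound
  obtain ⟨C₄, hC₄0, hC₄⟩ := (Φ.injective_iff_antilipschitz).1 hΦ
  have hC₄' : ∀ x, ‖x‖ ≤ C₄ * ‖Φ x‖ := fun x => by
    simpa using hC₄.le_mul_dist x 0
  refine ⟨1 + C₁ * C₄ + C₃ * C₂, by
    nlinarith [mul_nonneg hC₃0.le hC₂0, show (0 : ℝ) ≤ C₁ * C₄ from mul_nonneg hC₁0 C₄.2],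
    fun x => ?_, fun x => ?_⟩
  · calc N x ≤ C₁ * (C₄ * ‖Φ x‖) := (hC₁ x).trans (by gcongr; exact hC₄' x)
      _ = (0 + C₁ * C₄ + 0) * ‖Φ x‖ := by ring
      _ ≤ _ := by gcongr <;> positivity
  · calc ‖Φ x‖ ≤ C₃ * (C₂ * N x) := (hC₃ x).trans (by gcongr; exact hC₂ x)
      _ = (0 + 0 + C₃ * C₂) * N x := by ring
      _ ≤ _ := by gcongr <;> positivity

end Embedding

/-! ### Pointwise expansion of powers of a norm -/

section RealInequalities

/-- A power function of exponent at least one lies above its tangents. -/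
theorem rpow_tangent_le {q x y : ℝ} (hq : 1 ≤ q) (hx : 0 ≤ x) (hy : 0 ≤ y) :
    x ^ q + q * x ^ (q - 1) * (y - x) ≤ y ^ q := by
  rcases hx.eq_or_lt with rfl | hx
  · rcases hq.eq_or_lt with rfl | hq
    · simp
    · rw [Real.zero_rpow (by linarith), Real.zero_rpow (by linarith)]
      simpa using Real.rpow_nonneg hy q
  · have h := one_add_mul_self_le_rpow_one_add (s := y / x - 1) (by
      have : 0 ≤ y / x := by positivity
      linarith) hq
    rw [add_sub_cancel, Real.div_rpow hy hx.le, le_div_iff₀ (by positivity)] at h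
    have h2 : x ^ q = x ^ (q - 1) * x := by
      rw [← Real.rpow_add_one hx.ne']; ring_nf
    calc x ^ q + q * x ^ (q - 1) * (y - x) = (1 + q * (y / x - 1)) * x ^ q := by
          rw [h2]; field_simp
      _ ≤ y ^ q := h

/-- The exponent `p - 2` may be below one, where the power is not convex. For `a ≤ b`, multiplying
the difference by `b` raises the exponent to `p - 1 ≥ 1`, and the tangent at `b` applies. -/
theorem rpow_sub_mul_sq_sub_le {p a b t : ℝ} (hp : 2 ≤ p) (ha : 0 ≤ a) (hb : 0 ≤ b)
    (ht : |b - a| ≤ t) :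
    (b ^ (p - 2) - a ^ (p - 2)) * (b ^ 2 - a ^ 2) ≤
      2 * (p - 1) * (a ^ (p - 2) + b ^ (p - 2)) * t ^ 2 := by
  wlog hab : a ≤ b generalizing a b
  · have := this hb ha (by rwa [abs_sub_comm]) (by linarith)
    linarith
  rcases hb.eq_or_lt with rfl | hb
  · obtain rfl : a = 0 := by linarith
    have : 0 ≤ (0 : ℝ) ^ (p - 2) := Real.rpow_nonneg le_rfl _
    simp only [sub_self, mul_zero]
    have : 0 ≤ p - 1 := by linarith
    positivity
  have hr : 0 ≤ p - 2 := by linarith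
  have hd : (b - a) ^ 2 ≤ t ^ 2 := by
    rw [← sq_abs]; exact pow_le_pow_left₀ (abs_nonneg _) ht 2
  have h1 := rpow_tangent_le (q := p - 1) (by linarith) hb.le ha
  have h2 : a ^ (p - 1) ≤ a ^ (p - 2) * b := by
    rcases ha.eq_or_lt with rfl | ha
    · rw [Real.zero_rpow (by linarith)]
      have : 0 ≤ (0 : ℝ) ^ (p - 2) := Real.rpow_nonneg le_rfl _
      positivity
    · have : a ^ (p - 1) = a ^ (p - 2) * a := by
        rw [← Real.rpow_add_one ha.ne']; ring_nf
      rw [this]; gcongr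
  have h3 : b ^ (p - 1) = b ^ (p - 2) * b := by
    rw [← Real.rpow_add_one hb.ne']; ring_nf
  rw [show p - 1 - 1 = p - 2 by ring] at h1
  have h4 : (b ^ (p - 2) - a ^ (p - 2)) * b ≤ (p - 1) * b ^ (p - 2) * (b - a) := by
    nlinarith
  have h5 : 0 ≤ b ^ (p - 2) - a ^ (p - 2) := by
    have := Real.rpow_le_rpow ha hab hr
    linarith
  have h6 : 0 ≤ a ^ (p - 2) := by positivity
  have h7 : 0 ≤ b ^ (p - 2) := by positivity
  calc (b ^ (p - 2) - a ^ (p - 2)) * (b ^ 2 - a ^ 2)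
      = ((b ^ (p - 2) - a ^ (p - 2)) * (b - a)) * (b + a) := by ring
    _ ≤ ((b ^ (p - 2) - a ^ (p - 2)) * (b - a)) * (2 * b) := by
        have := mul_nonneg h5 (sub_nonneg.2 hab)
        gcongr; linarith
    _ = ((b ^ (p - 2) - a ^ (p - 2)) * b) * (2 * (b - a)) := by ring
    _ ≤ ((p - 1) * b ^ (p - 2) * (b - a)) * (2 * (b - a)) := by
        have := sub_nonneg.2 hab
        gcongr
    _ = 2 * (p - 1) * b ^ (p - 2) * (b - a) ^ 2 := by ring
    _ ≤ 2 * (p - 1) * (a ^ (p - 2) + b ^ (p - 2)) * t ^ 2 := by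
        have : 0 ≤ p - 1 := by linarith
        gcongr; linarith

/-- Second order expansion of `‖·‖ ^ p` in an inner product space. -/
theorem norm_add_rpow_le {H : Type*} [NormedAddCommGroup H] [InnerProductSpace ℝ H] {p : ℝ}
    (hp : 2 ≤ p) (x y : H) :
    ‖x + y‖ ^ p ≤ ‖x‖ ^ p + p * (‖x‖ ^ (p - 2) * inner ℝ x y) +
      p ^ 2 * (‖x‖ ^ (p - 2) * ‖y‖ ^ 2 + ‖x + y‖ ^ (p - 2) * ‖y‖ ^ 2) := by
  have e1 : ∀ z : H, (‖z‖ ^ 2) ^ (p / 2) = ‖z‖ ^ p := fun z => by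
    rw [← Real.rpow_natCast_mul (norm_nonneg _)]; congr 1; push_cast; ring
  have e2 : ∀ z : H, (‖z‖ ^ 2) ^ (p / 2 - 1) = ‖z‖ ^ (p - 2) := fun z => by
    rw [← Real.rpow_natCast_mul (norm_nonneg _)]; congr 1; push_cast; ring
  -- The tangent is taken at the new point `x + y`, which gives an upper bound; the slope is then
  -- moved back to `x`, so that the linear term has a coefficient known in the past.
  have h1 := rpow_tangent_le (q := p / 2) (x := ‖x + y‖ ^ 2) (y := ‖x‖ ^ 2) (by linarith)
    (by positivity) (by positivity)
  rw [e1, e1, e2] at h1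
  have h2 : |‖x + y‖ - ‖x‖| ≤ ‖y‖ := by
    simpa using abs_norm_sub_norm_le (x + y) x
  have h3 := rpow_sub_mul_sq_sub_le hp (norm_nonneg x) (norm_nonneg (x + y)) h2
  have h4 : ‖x + y‖ ^ 2 - ‖x‖ ^ 2 = 2 * inner ℝ x y + ‖y‖ ^ 2 := by
    rw [norm_add_sq_real]; ring
  have h5 : 0 ≤ ‖x‖ ^ (p - 2) * ‖y‖ ^ 2 := by positivity
  have h6 : 0 ≤ ‖x + y‖ ^ (p - 2) * ‖y‖ ^ 2 := by positivity
  set u := ‖x‖ ^ (p - 2)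
  set v := ‖x + y‖ ^ (p - 2)
  have h7 : p / 2 * v * (‖x + y‖ ^ 2 - ‖x‖ ^ 2) =
      p * (u * inner ℝ x y) + p / 2 * (u * ‖y‖ ^ 2) +
        p / 2 * ((v - u) * (‖x + y‖ ^ 2 - ‖x‖ ^ 2)) := by
    rw [h4]; ring
  have h8 : p / 2 * ((v - u) * (‖x + y‖ ^ 2 - ‖x‖ ^ 2)) ≤
      p / 2 * (2 * (p - 1) * (u + v) * ‖y‖ ^ 2) := by gcongr
  have h9 : 0 ≤ p / 2 * (u * ‖y‖ ^ 2) := by positivity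
  nlinarith

/-- `a ^ (p - r) * b ^ r ≤ a ^ p + b ^ p`, crudely. -/
theorem rpow_mul_rpow_le_add {p q r a b : ℝ} (hq : 0 ≤ q) (hr : 0 ≤ r) (hpqr : q + r = p)
    (ha : 0 ≤ a) (hb : 0 ≤ b) : a ^ q * b ^ r ≤ a ^ p + b ^ p := by
  have hm : ∀ c : ℝ, 0 ≤ c → c ^ q * c ^ r = c ^ p := fun c hc => by
    rw [← hpqr, Real.rpow_add_of_nonneg hc hq hr]
  rcases le_total a b with h | h
  · calc a ^ q * b ^ r ≤ b ^ q * b ^ r := by gcongr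
      _ = b ^ p := hm b hb
      _ ≤ _ := by have : 0 ≤ a ^ p := by positivity
                  linarith
  · calc a ^ q * b ^ r ≤ a ^ q * a ^ r := by gcongr
      _ = a ^ p := hm a ha
      _ ≤ _ := by have : 0 ≤ b ^ p := by positivity
                  linarith

end RealInequalities

/-! ### Integrability and Hölder bounds -/

section Moments

variable {Ω : Type*} {mΩ : MeasurableSpace Ω} {μ : Measure Ω} {H : Type*}
  [NormedAddCommGroup H] {p : ℝ}

theorem integrable_norm_rpow_of_memLp (hp : 0 < p) {X : Ω → H}
    (hX : MemLp X (ENNReal.ofReal p) μ) : Integrable (fun ω => ‖X ω‖ ^ p) μ := by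
  have := hX.integrable_norm_rpow (by simpa using hp) ENNReal.ofReal_ne_top
  rwa [ENNReal.toReal_ofReal hp.le] at this

theorem integrable_norm_rpow_mul (hp : 2 < p) {X Y : Ω → H}
    (hX : MemLp X (ENNReal.ofReal p) μ) (hY : MemLp Y (ENNReal.ofReal p) μ) :
    Integrable (fun ω => ‖X ω‖ ^ (p - 2) * ‖Y ω‖ ^ 2) μ := by
  refine ((integrable_norm_rpow_of_memLp (by linarith) hX).add
    (integrable_norm_rpow_of_memLp (by linarith) hY)).mono' ?_ ?_
  · exact ((hX.1.norm.aemeasurable.pow_const _).mul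
      (hY.1.norm.aemeasurable.pow_const _)).aestronglyMeasurable
  · refine ae_of_all _ fun ω => ?_
    rw [Real.norm_of_nonneg (by positivity)]
    have := rpow_mul_rpow_le_add (p := p) (q := p - 2) (r := 2) (by linarith) (by norm_num)
      (by ring) (norm_nonneg (X ω)) (norm_nonneg (Y ω))
    rw [Real.rpow_two] at this
    exact this

/-- Hölder with exponents `p / (p - 2)` and `p / 2`. Writing moments as `u ^ (p / 2)` makes `u` a
bound on the squared `L^p` norm, the quantity that adds up along the recursion. -/
theorem integral_norm_rpow_mul_le (hp : 2 < p) {X Y : Ω → H}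
    (hX : MemLp X (ENNReal.ofReal p) μ) (hY : MemLp Y (ENNReal.ofReal p) μ) {u v : ℝ}
    (hu : 0 ≤ u) (hv : 0 ≤ v) (hXu : ∫ ω, ‖X ω‖ ^ p ∂μ ≤ u ^ (p / 2))
    (hYv : ∫ ω, ‖Y ω‖ ^ p ∂μ ≤ v ^ (p / 2)) :
    ∫ ω, ‖X ω‖ ^ (p - 2) * ‖Y ω‖ ^ 2 ∂μ ≤ u ^ (p / 2 - 1) * v := by
  have hpq : (p / (p - 2)).HolderConjugate (p / 2) := by
    rw [Real.holderConjugate_iff]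
    refine ⟨(one_lt_div (by linarith)).2 (by linarith), ?_⟩
    field_simp; ring
  have hp2 : 0 < p - 2 := by linarith
  have e1 : ∀ ω, (‖X ω‖ ^ (p - 2)) ^ (p / (p - 2)) = ‖X ω‖ ^ p := fun ω => by
    rw [← Real.rpow_mul (norm_nonneg _)]; congr 1; field_simp
  have e2 : ∀ ω, (‖Y ω‖ ^ 2) ^ (p / 2) = ‖Y ω‖ ^ p := fun ω => by
    rw [← Real.rpow_natCast_mul (norm_nonneg _)]; congr 1; push_cast; ring
  have hf : MemLp (fun ω => ‖X ω‖ ^ (p - 2)) (ENNReal.ofReal (p / (p - 2))) μ := by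
    rw [← integrable_norm_rpow_iff (hX.1.norm.aemeasurable.pow_const _).aestronglyMeasurable
      (by simp; positivity) ENNReal.ofReal_ne_top, ENNReal.toReal_ofReal (by positivity)]
    refine (integrable_norm_rpow_of_memLp (by linarith) hX).congr (ae_of_all _ fun ω => ?_)
    simp only
    rw [Real.norm_of_nonneg (by positivity), e1]
  have hg : MemLp (fun ω => ‖Y ω‖ ^ 2) (ENNReal.ofReal (p / 2)) μ := by
    rw [← integrable_norm_rpow_iff (hY.1.norm.aemeasurable.pow_const _).aestronglyMeasurable
      (by simp; positivity) ENNReal.ofReal_ne_top, ENNReal.toReal_ofReal (by positivity)]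
    refine (integrable_norm_rpow_of_memLp (by linarith) hY).congr (ae_of_all _ fun ω => ?_)
    simp only
    rw [Real.norm_of_nonneg (by positivity), e2]
  have h := integral_mul_le_Lp_mul_Lq_of_nonneg hpq (ae_of_all μ fun ω => by positivity)
    (ae_of_all μ fun ω => by positivity) hf hg
  simp only [e1, e2] at h
  refine h.trans ?_
  have e3 : (u ^ (p / 2)) ^ (1 / (p / (p - 2))) = u ^ (p / 2 - 1) := by
    rw [← Real.rpow_mul hu]; congr 1; field_simp
  have e4 : (v ^ (p / 2)) ^ (1 / (p / 2)) = v := by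
    rw [← Real.rpow_mul hv, mul_one_div_cancel (by positivity), Real.rpow_one]
  rw [← e3]
  have i1 : 0 ≤ ∫ ω, ‖X ω‖ ^ p ∂μ := integral_nonneg fun ω => by positivity
  have i2 : 0 ≤ ∫ ω, ‖Y ω‖ ^ p ∂μ := integral_nonneg fun ω => by positivity
  refine mul_le_mul (by gcongr) ?_ (by positivity) (by positivity)
  refine (Real.rpow_le_rpow i2 hYv (by positivity)).trans e4.le

theorem integrable_norm_rpow_mul_inner [InnerProductSpace ℝ H] (hp : 2 < p) {U V : Ω → H}
    (hU : MemLp U (ENNReal.ofReal p) μ) (hV : MemLp V (ENNReal.ofReal p) μ) :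
    Integrable (fun ω => ‖U ω‖ ^ (p - 2) * inner ℝ (U ω) (V ω)) μ := by
  refine ((integrable_norm_rpow_of_memLp (by linarith) hU).add
    (integrable_norm_rpow_of_memLp (by linarith) hV)).mono' ?_ ?_
  · exact (hU.1.norm.aemeasurable.pow_const _).aestronglyMeasurable.mul (hU.1.inner hV.1)
  · refine ae_of_all _ fun ω => ?_
    have := rpow_mul_rpow_le_add (p := p) (q := p - 1) (r := 1) (by linarith) (by norm_num)
      (by ring) (norm_nonneg (U ω)) (norm_nonneg (V ω))
    refine le_trans ?_ this
    rw [norm_mul, Real.norm_of_nonneg (by positivity), Real.rpow_one]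
    calc _ ≤ ‖U ω‖ ^ (p - 2) * (‖U ω‖ * ‖V ω‖) := by gcongr; exact norm_inner_le_norm _ _
      _ = ‖U ω‖ ^ (p - 2 + 1) * ‖V ω‖ := by
        rw [Real.rpow_add_one' (norm_nonneg _) (by linarith)]; ring
      _ = _ := by ring_nf

end Moments

/-! ### One step with a conditionally centred increment -/

section MartingaleStep

variable {Ω : Type*} {m mΩ : MeasurableSpace Ω} {μ : Measure Ω} [IsProbabilityMeasure μ]
  {H : Type*} [NormedAddCommGroup H] [InnerProductSpace ℝ H] [CompleteSpace H] {p : ℝ}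

/-- The factor `‖U‖ ^ (p - 2) • U` is `m`-measurable and pulls out of the conditional expectation.
The alternative `U = 0` covers time zero, where the noise need not be centred. -/
theorem setIntegral_norm_rpow_mul_inner_eq_zero (hm : m ≤ mΩ) (hp : 2 < p) {U V : Ω → H}
    (hUm : StronglyMeasurable[m] U)
    (hU : MemLp U (ENNReal.ofReal p) μ) (hV : MemLp V (ENNReal.ofReal p) μ)
    (hUV : U = 0 ∨ μ[V | m] =ᵐ[μ] 0) {A : Set Ω} (hA : MeasurableSet[m] A) :
    ∫ ω in A, ‖U ω‖ ^ (p - 2) * inner ℝ (U ω) (V ω) ∂μ = 0 := by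
  rcases hUV with rfl | hUV
  · simp
  have hint := integrable_norm_rpow_mul_inner hp hU hV
  have hVi : Integrable V μ := hV.integrable (by
    rw [← ENNReal.ofReal_one]; exact ENNReal.ofReal_le_ofReal (by linarith))
  have hZ : StronglyMeasurable[m] fun ω => ‖U ω‖ ^ (p - 2) • U ω :=
    ((hUm.norm.measurable.pow_const _).stronglyMeasurable).smul hUm
  have hZV : (fun ω => ‖U ω‖ ^ (p - 2) * inner ℝ (U ω) (V ω)) =
      fun ω => inner ℝ (‖U ω‖ ^ (p - 2) • U ω) (V ω) := by
    ext ω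
    rw [real_inner_smul_left]
  have hce : μ[fun ω => inner ℝ (‖U ω‖ ^ (p - 2) • U ω) (V ω) | m] =ᵐ[μ]
      fun ω => inner ℝ (‖U ω‖ ^ (p - 2) • U ω) (μ[V | m] ω) :=
    condExp_bilin_of_stronglyMeasurable_left (μ := μ) (innerSL ℝ) hZ (g := V)
      (hZV ▸ hint) hVi
  rw [← hZV] at hce
  rw [← setIntegral_condExp hm hint hA]
  rw [integral_eq_zero_of_ae]
  refine ae_restrict_of_ae ?_
  filter_upwards [hce, hUV] with ω h1 h2
  rw [h1, h2]
  simp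

/-- Localizing to a past event `A` is what the maximal inequality needs; the quadratic remainder is
nonnegative and is bounded by its integral over the whole space. -/
theorem setIntegral_norm_add_rpow_le (hm : m ≤ mΩ) (hp : 2 < p) {U V : Ω → H}
    (hUm : StronglyMeasurable[m] U)
    (hU : MemLp U (ENNReal.ofReal p) μ) (hV : MemLp V (ENNReal.ofReal p) μ)
    (hUV : U = 0 ∨ μ[V | m] =ᵐ[μ] 0) {A : Set Ω} (hA : MeasurableSet[m] A) {u v w : ℝ}
    (hu : 0 ≤ u) (hv : 0 ≤ v) (hw : 0 ≤ w) (hUu : ∫ ω, ‖U ω‖ ^ p ∂μ ≤ u ^ (p / 2))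
    (hVv : ∫ ω, ‖V ω‖ ^ p ∂μ ≤ v ^ (p / 2))
    (hUVw : ∫ ω, ‖U ω + V ω‖ ^ p ∂μ ≤ w ^ (p / 2)) :
    ∫ ω in A, ‖U ω + V ω‖ ^ p ∂μ ≤
      ∫ ω in A, ‖U ω‖ ^ p ∂μ + p ^ 2 * (u ^ (p / 2 - 1) * v + w ^ (p / 2 - 1) * v) := by
  have hp0 : 0 < p := by linarith
  have hS : MemLp (fun ω => U ω + V ω) (ENNReal.ofReal p) μ := hU.add hV
  have i0 := integrable_norm_rpow_of_memLp hp0 hS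
  have i1 := integrable_norm_rpow_of_memLp hp0 hU
  have i2 := integrable_norm_rpow_mul_inner hp hU hV
  have i3 := integrable_norm_rpow_mul hp hU hV
  have i4 := integrable_norm_rpow_mul hp hS hV
  have i12 : Integrable (fun ω => ‖U ω‖ ^ p + p * (‖U ω‖ ^ (p - 2) * inner ℝ (U ω) (V ω))) μ :=
    i1.add (i2.const_mul p)
  have i5 : Integrable (fun ω => ‖U ω‖ ^ (p - 2) * ‖V ω‖ ^ 2 +
      ‖U ω + V ω‖ ^ (p - 2) * ‖V ω‖ ^ 2) μ := i3.add i4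
  have i34 := i5.const_mul (p ^ 2)
  have i6 : Integrable (fun ω => ‖U ω‖ ^ p + p * (‖U ω‖ ^ (p - 2) * inner ℝ (U ω) (V ω)) +
      p ^ 2 * (‖U ω‖ ^ (p - 2) * ‖V ω‖ ^ 2 + ‖U ω + V ω‖ ^ (p - 2) * ‖V ω‖ ^ 2)) μ := i12.add i34
  calc ∫ ω in A, ‖U ω + V ω‖ ^ p ∂μ
      ≤ ∫ ω in A, ((‖U ω‖ ^ p + p * (‖U ω‖ ^ (p - 2) * inner ℝ (U ω) (V ω))) +
        p ^ 2 * (‖U ω‖ ^ (p - 2) * ‖V ω‖ ^ 2 + ‖U ω + V ω‖ ^ (p - 2) * ‖V ω‖ ^ 2)) ∂μ :=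
        integral_mono i0.integrableOn i6.integrableOn
          fun ω => norm_add_rpow_le hp.le _ _
    _ = ∫ ω in A, ‖U ω‖ ^ p ∂μ + p ^ 2 * ∫ ω in A,
        (‖U ω‖ ^ (p - 2) * ‖V ω‖ ^ 2 + ‖U ω + V ω‖ ^ (p - 2) * ‖V ω‖ ^ 2) ∂μ := by
        rw [integral_add i12.integrableOn i34.integrableOn,
          integral_add i1.integrableOn (i2.const_mul p).integrableOn, integral_const_mul,
          integral_const_mul, setIntegral_norm_rpow_mul_inner_eq_zero hm hp hUm hU hV hUV hA]
        simp
    _ ≤ _ := by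
        gcongr
        refine (setIntegral_le_integral i5 (ae_of_all _ fun ω => ?_)).trans ?_
        · simp only [Pi.zero_apply]; positivity
        · rw [integral_add i3 i4]
          exact add_le_add (integral_norm_rpow_mul_le hp hU hV hu hv hUu hVv)
            (integral_norm_rpow_mul_le hp hS hV hw hv hUVw hVv)

/-- Two-smoothness of `L^p` for a conditionally centred increment. -/
theorem integral_norm_add_rpow_le (hm : m ≤ mΩ) (hp : 2 < p) {U V : Ω → H}
    (hUm : StronglyMeasurable[m] U)
    (hU : MemLp U (ENNReal.ofReal p) μ) (hV : MemLp V (ENNReal.ofReal p) μ)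
    (hUV : U = 0 ∨ μ[V | m] =ᵐ[μ] 0) {u v : ℝ}
    (hu : 0 ≤ u) (hv : 0 ≤ v) (hUu : ∫ ω, ‖U ω‖ ^ p ∂μ ≤ u ^ (p / 2))
    (hVv : ∫ ω, ‖V ω‖ ^ p ∂μ ≤ v ^ (p / 2)) :
    ∫ ω, ‖U ω + V ω‖ ^ p ∂μ ≤ (u + 2 * p ^ 2 * v) ^ (p / 2) := by
  have hF0 : 0 ≤ ∫ ω, ‖U ω + V ω‖ ^ p ∂μ := integral_nonneg fun ω => by positivity
  set F := ∫ ω, ‖U ω + V ω‖ ^ p ∂μ with hF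
  set f := F ^ (2 / p) with hf
  have hf0 : 0 ≤ f := by positivity
  have hp0 : 0 < p := by linarith
  have hfF : F = f ^ (p / 2) := by
    rw [hf, ← Real.rpow_mul hF0, div_mul_div_cancel₀ hp0.ne', div_self two_ne_zero,
      Real.rpow_one]
  -- The bound on `f`, the squared `L^p` norm of the sum, involves `f` itself. If `f > u`, then `f ^
  -- (p / 2 - 1)` dominates every similar factor and can be cancelled.
  rcases le_or_gt f u with h | h
  · rw [hfF]
    gcongr
    have : 0 ≤ 2 * p ^ 2 * v := by positivity
    linarith
  · have hfpos : 0 < f := hu.trans_lt h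
    have h1 := setIntegral_norm_add_rpow_le hm hp hUm hU hV hUV (A := Set.univ)
      MeasurableSet.univ hu hv hf0 hUu hVv (by rw [← hF, hfF])
    simp only [Measure.restrict_univ] at h1
    rw [← hF] at h1
    have h2 : u ^ (p / 2 - 1) ≤ f ^ (p / 2 - 1) :=
      Real.rpow_le_rpow hu h.le (by linarith)
    have h3 : ∀ x : ℝ, 0 ≤ x → x ^ (p / 2) = x ^ (p / 2 - 1) * x := fun x hx => by
      rw [← Real.rpow_add_one' hx (by linarith)]; ring_nf
    have h4 : f ^ (p / 2 - 1) * f ≤ f ^ (p / 2 - 1) * (u + 2 * p ^ 2 * v) := by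
      calc f ^ (p / 2 - 1) * f = F := by rw [← h3 f hf0, hfF]
        _ ≤ u ^ (p / 2) + p ^ 2 * (u ^ (p / 2 - 1) * v + f ^ (p / 2 - 1) * v) :=
          h1.trans (by gcongr)
        _ = u ^ (p / 2 - 1) * u + p ^ 2 * (u ^ (p / 2 - 1) * v + f ^ (p / 2 - 1) * v) := by
          rw [h3 u hu]
        _ ≤ f ^ (p / 2 - 1) * u + p ^ 2 * (f ^ (p / 2 - 1) * v + f ^ (p / 2 - 1) * v) := by
          gcongr
        _ = _ := by ring
    have h5 := le_of_mul_le_mul_left h4 (by positivity)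
    rw [hfF]
    gcongr

end MartingaleStep

/-! ### A maximal inequality with drift -/

section MaximalInequality

variable {Ω : Type*} {mΩ : MeasurableSpace Ω} {μ : Measure Ω} [IsFiniteMeasure μ]

/-- Markov's inequality that retains the mass on which level one is not reached. -/
theorem measureReal_inter_add_setIntegral_le {B : Set Ω} (hB : MeasurableSet B) {W : Ω → ℝ}
    (hWm : Measurable W) (hWi : Integrable W μ) :
    μ.real (B ∩ {ω | 1 ≤ W ω}) + ∫ ω in B ∩ {ω | W ω < 1}, W ω ∂μ ≤ ∫ ω in B, W ω ∂μ := by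
  have hS : MeasurableSet {ω | 1 ≤ W ω} := measurableSet_le measurable_const hWm
  have hc : {ω | W ω < 1} = {ω | 1 ≤ W ω}ᶜ := by ext; simp
  have h1 := integral_inter_add_sdiff (μ := μ) (s := B) hS hWi.integrableOn
  rw [hc, ← Set.sdiff_eq]
  have := setIntegral_ge_of_const_le_real (μ := μ) (f := W) (c := 1) (hB.inter hS)
    (measure_ne_top _ _) (fun ω hω => hω.2) hWi.integrableOn
  linarith

/-- A maximal inequality of Hájek–Rényi type: the probability of ever reaching level one is
controlled by the sum of the drifts of the process, killed when it has reached level one. -/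
theorem measureReal_exists_one_le_le {W : ℕ → Ω → ℝ} (hWm : ∀ n, Measurable (W n))
    (hW0 : ∀ n ω, 0 ≤ W n ω) (hWi : ∀ n, Integrable (W n) μ) {β : ℕ → ℝ} (n : ℕ)
    (h : ∀ k < n, ∫ ω in {ω | ∀ r ≤ k, W r ω < 1}, W (k + 1) ω ∂μ ≤
      ∫ ω in {ω | ∀ r ≤ k, W r ω < 1}, W k ω ∂μ + β k) :
    μ.real {ω | ∃ r ≤ n, 1 ≤ W r ω} ≤ ∫ ω, W 0 ω ∂μ + ∑ k ∈ Finset.range n, β k := by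
  have hBm : ∀ n, MeasurableSet {ω | ∀ r ≤ n, W r ω < 1} := fun n => by
    simp only [Set.ofPred_forall]
    exact MeasurableSet.iInter fun r => MeasurableSet.iInter fun _ =>
      measurableSet_lt (hWm r) measurable_const
  have key : ∀ j ≤ n, μ.real {ω | ∃ r ≤ j, 1 ≤ W r ω} +
      ∫ ω in {ω | ∀ r ≤ j, W r ω < 1}, W j ω ∂μ ≤
        ∫ ω, W 0 ω ∂μ + ∑ k ∈ Finset.range j, β k := by
    intro j
    induction j with
    | zero =>
      intro _
      have := measureReal_inter_add_setIntegral_le (μ := μ) MeasurableSet.univ (hWm 0) (hWi 0)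
      simpa using this
    | succ j ih =>
      intro hj
      have h1 := measureReal_inter_add_setIntegral_le (μ := μ) (hBm j) (hWm (j + 1)) (hWi (j + 1))
      have h2 := h j (by omega)
      have h3 := ih (by omega)
      have e1 : {ω | ∃ r ≤ j + 1, 1 ≤ W r ω} = {ω | ∃ r ≤ j, 1 ≤ W r ω} ∪
          ({ω | ∀ r ≤ j, W r ω < 1} ∩ {ω | 1 ≤ W (j + 1) ω}) := by
        ext ω
        simp only [Set.mem_ofPred_eq, Set.mem_union, Set.mem_inter_iff]
        constructor
        · rintro ⟨r, hr, hr1⟩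
          by_cases hex : ∃ r ≤ j, 1 ≤ W r ω
          · exact Or.inl hex
          · push Not at hex
            rcases Nat.le_succ_iff.1 hr with hr | rfl
            · exact absurd hr1 (not_le.2 (hex r hr))
            · exact Or.inr ⟨hex, hr1⟩
        · rintro (⟨r, hr, hr1⟩ | ⟨_, h⟩)
          · exact ⟨r, by omega, hr1⟩
          · exact ⟨j + 1, le_rfl, h⟩
      have e2 : {ω | ∀ r ≤ j + 1, W r ω < 1} =
          {ω | ∀ r ≤ j, W r ω < 1} ∩ {ω | W (j + 1) ω < 1} := by
        ext ω
        simp only [Set.mem_ofPred_eq, Set.mem_inter_iff]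
        refine ⟨fun h => ⟨fun r hr => h r (by omega), h _ le_rfl⟩, fun h r hr => ?_⟩
        rcases Nat.le_succ_iff.1 hr with hr | rfl
        exacts [h.1 r hr, h.2]
      rw [e1, e2, Finset.sum_range_succ]
      have h4 := measureReal_union_le (μ := μ) {ω | ∃ r ≤ j, 1 ≤ W r ω}
        ({ω | ∀ r ≤ j, W r ω < 1} ∩ {ω | 1 ≤ W (j + 1) ω})
      linarith
  have h5 : 0 ≤ ∫ ω in {ω | ∀ r ≤ n, W r ω < 1}, W n ω ∂μ := integral_nonneg (hW0 n)
  linarith [key n le_rfl]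

end MaximalInequality

/-! ### Moments and maximal tails of perturbed contractions -/

section Recursion

variable {Ω : Type*} {mΩ : MeasurableSpace Ω} {μ : Measure Ω}
  {H : Type*} [NormedAddCommGroup H] [InnerProductSpace ℝ H] {p : ℝ}

/-- A process `Y (t + 1) = U t + V t` in a Hilbert space, where `U t` is known at time `t` and
bounded by `ρ t * ‖Y t‖`, and `V t` is conditionally centred (unless `U t = 0`) with `p`-th
moment at most `v t ^ (p / 2)`. -/
structure IsPerturbedContraction (μ : Measure Ω) (p : ℝ) (𝒢 : ℕ → MeasurableSpace Ω)
    (Y U V : ℕ → Ω → H) (ρ v : ℕ → ℝ) : Prop where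
  le : ∀ t, 𝒢 t ≤ mΩ
  mono : Monotone 𝒢
  zero : Y 0 = 0
  succ : ∀ t, Y (t + 1) = fun ω => U t ω + V t ω
  measY : ∀ t, StronglyMeasurable[𝒢 t] (Y t)
  measU : ∀ t, StronglyMeasurable[𝒢 t] (U t)
  norm_le : ∀ t ω, ‖U t ω‖ ≤ ρ t * ‖Y t ω‖
  rho_nonneg : ∀ t, 0 ≤ ρ t
  memLp : ∀ t, MemLp (V t) (ENNReal.ofReal p) μ
  v_nonneg : ∀ t, 0 ≤ v t
  moment_le : ∀ t, ∫ ω, ‖V t ω‖ ^ p ∂μ ≤ v t ^ (p / 2)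
  centred : ∀ t, U t = 0 ∨ μ[V t | 𝒢 t] =ᵐ[μ] 0

variable {𝒢 : ℕ → MeasurableSpace Ω} {Y U V : ℕ → Ω → H} {ρ v : ℕ → ℝ}

theorem IsPerturbedContraction.memLp_U (h : IsPerturbedContraction μ p 𝒢 Y U V ρ v) {t : ℕ}
    (hY : MemLp (Y t) (ENNReal.ofReal p) μ) : MemLp (U t) (ENNReal.ofReal p) μ :=
  hY.of_le_mul ((h.measU t).mono (h.le t)).aestronglyMeasurable (ae_of_all _ (h.norm_le t))

theorem IsPerturbedContraction.moment_U_le (h : IsPerturbedContraction μ p 𝒢 Y U V ρ v)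
    (hp : 2 < p) {t : ℕ} (hY : MemLp (Y t) (ENNReal.ofReal p) μ) {u : ℝ} (hu : 0 ≤ u)
    (hYu : ∫ ω, ‖Y t ω‖ ^ p ∂μ ≤ u ^ (p / 2)) :
    ∫ ω, ‖U t ω‖ ^ p ∂μ ≤ (ρ t ^ 2 * u) ^ (p / 2) := by
  have hp0 : 0 < p := by linarith
  have hρ := h.rho_nonneg t
  calc ∫ ω, ‖U t ω‖ ^ p ∂μ ≤ ∫ ω, ρ t ^ p * ‖Y t ω‖ ^ p ∂μ := by
        refine integral_mono (integrable_norm_rpow_of_memLp hp0 (h.memLp_U hY))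
          ((integrable_norm_rpow_of_memLp hp0 hY).const_mul _) fun ω => ?_
        simp only
        rw [← Real.mul_rpow hρ (norm_nonneg _)]
        exact Real.rpow_le_rpow (norm_nonneg _) (h.norm_le t ω) hp0.le
    _ = ρ t ^ p * ∫ ω, ‖Y t ω‖ ^ p ∂μ := integral_const_mul _ _
    _ ≤ ρ t ^ p * u ^ (p / 2) := by gcongr
    _ = _ := by
      rw [Real.mul_rpow (by positivity) hu, ← Real.rpow_natCast_mul hρ]
      congr 2; push_cast; ring

variable [IsProbabilityMeasure μ] [CompleteSpace H]

/-- Factoring out `p ^ 2` leaves a recursion for `b` without `p`; hence the final constant is only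
linear in the exponent. -/
theorem IsPerturbedContraction.moment_bound (h : IsPerturbedContraction μ p 𝒢 Y U V ρ v)
    (hp : 2 < p) {b : ℕ → ℝ} (hb0 : 0 ≤ b 0) (hb : ∀ t, b (t + 1) = ρ t ^ 2 * b t + 2 * v t)
    (t : ℕ) :
    MemLp (Y t) (ENNReal.ofReal p) μ ∧ 0 ≤ b t ∧
      ∫ ω, ‖Y t ω‖ ^ p ∂μ ≤ (p ^ 2 * b t) ^ (p / 2) := by
  induction t with
  | zero =>
    refine ⟨by rw [h.zero]; exact MemLp.zero, hb0, ?_⟩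
    rw [h.zero]
    simp only [Pi.zero_apply, norm_zero]
    rw [Real.zero_rpow (by linarith)]
    simp only [integral_zero]
    positivity
  | succ t ih =>
    obtain ⟨hY, hbt, hm⟩ := ih
    have hU := h.memLp_U hY
    have hv := h.v_nonneg t
    refine ⟨by rw [h.succ]; exact hU.add (h.memLp t), by rw [hb]; positivity, ?_⟩
    have h1 := h.moment_U_le hp hY (by positivity) hm
    have h2 := integral_norm_add_rpow_le (h.le t) hp (h.measU t) hU (h.memLp t) (h.centred t)
      (by positivity) hv h1 (h.moment_le t)
    rw [h.succ, hb]
    refine h2.trans (le_of_eq ?_)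
    congr 1; ring

/-- After time `s` the contraction pays for the change of the weight `(l η t) ^ p`, and only the
quadratic noise term drifts. Before `s` nothing contracts, but the whole moment is affordable as
drift because `1 ≤ D * η t`. -/
theorem IsPerturbedContraction.measureReal_exists_le_norm_le
    (h : IsPerturbedContraction μ p 𝒢 Y U V ρ v) (hp : 2 < p) {η : ℕ → ℝ} (hη0 : ∀ t, 0 < η t)
    (hη : Antitone η) {b : ℕ → ℝ} (hb0 : 0 ≤ b 0)
    (hb : ∀ t, b (t + 1) = ρ t ^ 2 * b t + 2 * v t) {K : ℝ} (hbK : ∀ t, b t ≤ K * η t)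
    (hvK : ∀ t, 2 * v t ≤ K * η t ^ 2) {s : ℕ} (hρ1 : ∀ t, s ≤ t → ρ t ≤ 1)
    (hρη : ∀ t, s ≤ t → ρ t * η t ≤ η (t + 1)) (hη2 : ∀ t, s ≤ t → η t ≤ 2 * η (t + 1))
    {D : ℝ} (hD1 : 1 ≤ D) (hD : ∀ t, t < s → 1 ≤ D * η t) {l : ℝ} (hl : 0 < l) (n : ℕ) :
    μ.real {ω | ∃ r ≤ n, l * η r ≤ ‖Y r ω‖} ≤
      D * (∑ k ∈ Finset.range n, η k) * (4 * (p ^ 2 * K) / (l ^ 2 * η n)) ^ (p / 2) := by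
  have hp0 : 0 < p := by linarith
  have hY := h.moment_bound hp hb0 hb
  have hK : 0 ≤ K := by
    have := (hY 0).2.1.trans (hbK 0)
    exact nonneg_of_mul_nonneg_left this (hη0 0)
  have hl' : ∀ t, 0 < l * η t := fun t => mul_pos hl (hη0 t)
  have hYK : ∀ t, ∫ ω, ‖Y t ω‖ ^ p ∂μ ≤ (p ^ 2 * K * η t) ^ (p / 2) := fun t =>
    (hY t).2.2.trans (Real.rpow_le_rpow (by have := (hY t).2.1; positivity)
      (by rw [mul_assoc]; gcongr; exact hbK t) (by linarith))
  set W : ℕ → Ω → ℝ := fun t ω => ‖Y t ω‖ ^ p / (l * η t) ^ p with hW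
  have hWm' : ∀ t, Measurable[𝒢 t] (W t) := fun t =>
    (((h.measY t).norm.measurable).pow_const _).div_const _
  have hWm : ∀ t, Measurable (W t) := fun t => (hWm' t).mono (h.le t) le_rfl
  have hWi : ∀ t, Integrable (W t) μ := fun t =>
    (integrable_norm_rpow_of_memLp hp0 (hY t).1).div_const _
  have hW0 : ∀ t ω, 0 ≤ W t ω := fun t ω => by have := hl' t; positivity
  have hW1 : ∀ t ω, 1 ≤ W t ω ↔ l * η t ≤ ‖Y t ω‖ := fun t ω => by
    have := hl' t
    rw [hW, le_div_iff₀ (by positivity), one_mul,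
      Real.rpow_le_rpow_iff this.le (norm_nonneg _) hp0]
  have hBm : ∀ k, MeasurableSet[𝒢 k] {ω | ∀ r ≤ k, W r ω < 1} := fun k => by
    have : {ω | ∀ r ≤ k, W r ω < 1} = ⋂ r, ⋂ (_ : r ≤ k), {ω | W r ω < 1} := by
      simp only [Set.ofPred_forall]
    rw [this]
    exact MeasurableSet.iInter fun r => MeasurableSet.iInter fun hr =>
      (h.mono hr) _ ((hWm' r) measurableSet_Iio)
  have hsq : ∀ t, (l * η t) ^ p = (l ^ 2 * η t * η t) ^ (p / 2) := fun t => by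
    rw [show l ^ 2 * η t * η t = (l * η t) ^ 2 by ring, ← Real.rpow_natCast_mul (hl' t).le]
    congr 1; push_cast; ring
  -- The ratio of moment to squared threshold grows as `η` falls, so its value at `n` serves all `k
  -- ≤ n`. The factor `4` comes from `η k ≤ 2 * η (k + 1)`, squared.
  set Q := (4 * (p ^ 2 * K) / (l ^ 2 * η n)) ^ (p / 2) with hQ
  have hQ0 : 0 ≤ Q := by have := hη0 n; positivity
  have hQle : ∀ k ≤ n, ∀ x, 0 ≤ x → x ≤ 4 * (p ^ 2 * K * η k) / (l ^ 2 * η k * η k) →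
      x ^ (p / 2) ≤ Q := by
    intro k hk x hx hxk
    have := hη0 k
    have := hη0 n
    refine Real.rpow_le_rpow hx (hxk.trans ?_) (by linarith)
    rw [show 4 * (p ^ 2 * K * η k) / (l ^ 2 * η k * η k) = 4 * (p ^ 2 * K) / (l ^ 2 * η k) by
      field_simp]
    gcongr
    exact hη hk
  have key : ∀ k < n, ∫ ω in {ω | ∀ r ≤ k, W r ω < 1}, W (k + 1) ω ∂μ ≤
      ∫ ω in {ω | ∀ r ≤ k, W r ω < 1}, W k ω ∂μ + D * η k * Q := by
    intro k hk
    have hk0 := hη0 k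
    have hk1 := hη0 (k + 1)
    have hlk := hl' k
    have hlk1 := hl' (k + 1)
    have hI0 : 0 ≤ ∫ ω in {ω | ∀ r ≤ k, W r ω < 1}, W k ω ∂μ := integral_nonneg (hW0 k)
    rcases lt_or_ge k s with hks | hks
    · have h1 : ∫ ω in {ω | ∀ r ≤ k, W r ω < 1}, W (k + 1) ω ∂μ ≤ Q := by
        refine (setIntegral_le_integral (hWi _) (ae_of_all _ (hW0 _))).trans ?_
        rw [hW, integral_div]
        calc _ ≤ (p ^ 2 * K * η (k + 1)) ^ (p / 2) / (l * η (k + 1)) ^ p := by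
              gcongr; exact hYK _
          _ = (p ^ 2 * K * η (k + 1) / (l ^ 2 * η (k + 1) * η (k + 1))) ^ (p / 2) := by
              rw [hsq, Real.div_rpow (by positivity) (by positivity)]
          _ ≤ Q := by
              refine hQle (k + 1) (by omega) _ (by positivity) ?_
              have : 0 ≤ p ^ 2 * K * η (k + 1) := by positivity
              refine div_le_div_of_nonneg_right ?_ (by positivity)
              linarith
      have h2 : 1 * Q ≤ D * η k * Q := by gcongr; exact hD k hks
      linarith
    · set B := {ω | ∀ r ≤ k, W r ω < 1} with hB
      set a := p ^ 2 * K * η k with ha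
      have ha0 : 0 ≤ a := by positivity
      have hv0 := h.v_nonneg k
      have hρ0 := h.rho_nonneg k
      have hUa : ∫ ω, ‖U k ω‖ ^ p ∂μ ≤ a ^ (p / 2) := by
        refine (h.moment_U_le hp (hY k).1 ha0 (hYK k)).trans ?_
        refine Real.rpow_le_rpow (by positivity) ?_ (by linarith)
        exact mul_le_of_le_one_left ha0 (pow_le_one₀ hρ0 (hρ1 k hks))
      have hYa : ∫ ω, ‖U k ω + V k ω‖ ^ p ∂μ ≤ a ^ (p / 2) := by
        have := hYK (k + 1)
        rw [h.succ] at this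
        refine this.trans (Real.rpow_le_rpow (by positivity) ?_ (by linarith))
        rw [ha]; gcongr; exact hη (Nat.le_succ k)
      have h1 := setIntegral_norm_add_rpow_le (h.le k) hp (h.measU k) (h.memLp_U (hY k).1)
        (h.memLp k) (h.centred k) (hBm k) ha0 hv0 ha0 hUa (h.moment_le k) hYa
      have h2 : (∫ ω in B, ‖U k ω‖ ^ p ∂μ) / (l * η (k + 1)) ^ p ≤ ∫ ω in B, W k ω ∂μ := by
        rw [← integral_div]
        refine integral_mono
          ((integrable_norm_rpow_of_memLp hp0 (h.memLp_U (hY k).1)).div_const _).integrableOn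
          (hWi k).integrableOn fun ω => ?_
        simp only [hW]
        rw [← Real.div_rpow (norm_nonneg _) hlk1.le, ← Real.div_rpow (norm_nonneg _) hlk.le]
        refine Real.rpow_le_rpow (by positivity) ?_ hp0.le
        rw [div_le_div_iff₀ hlk1 hlk]
        calc ‖U k ω‖ * (l * η k) ≤ (ρ k * ‖Y k ω‖) * (l * η k) := by
              gcongr; exact h.norm_le k ω
          _ = ‖Y k ω‖ * (l * (ρ k * η k)) := by ring
          _ ≤ _ := by gcongr; exact hρη k hks
      have h3 : p ^ 2 * (a ^ (p / 2 - 1) * v k + a ^ (p / 2 - 1) * v k) / (l * η (k + 1)) ^ p ≤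
          η k * Q := by
        have e1 : a ^ (p / 2 - 1) * a = a ^ (p / 2) := by
          rw [← Real.rpow_add_one' ha0 (by linarith)]; ring_nf
        calc p ^ 2 * (a ^ (p / 2 - 1) * v k + a ^ (p / 2 - 1) * v k) / (l * η (k + 1)) ^ p
            = a ^ (p / 2 - 1) * (p ^ 2 * (2 * v k)) / (l * η (k + 1)) ^ p := by ring
          _ ≤ a ^ (p / 2 - 1) * (p ^ 2 * (K * η k ^ 2)) / (l * (η k / 2)) ^ p := by
              have := hvK k
              have : η k / 2 ≤ η (k + 1) := by linarith [hη2 k hks]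
              refine div_le_div₀ (by positivity) ?_ (by positivity) (by gcongr)
              exact mul_le_mul_of_nonneg_left (mul_le_mul_of_nonneg_left (hvK k)
                (by positivity)) (by positivity)
          _ = η k * (a ^ (p / 2) / (l ^ 2 * (η k / 2) * (η k / 2)) ^ (p / 2)) := by
              rw [← e1, show l ^ 2 * (η k / 2) * (η k / 2) = (l * (η k / 2)) ^ 2 by ring,
                ← Real.rpow_natCast_mul (by positivity),
                show ((2 : ℕ) : ℝ) * (p / 2) = p by push_cast; ring, ha]
              ring
          _ = η k * (a / (l ^ 2 * (η k / 2) * (η k / 2))) ^ (p / 2) := by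
              rw [Real.div_rpow ha0 (by positivity)]
          _ ≤ η k * Q := by
              gcongr
              refine hQle k hk.le _ (by positivity) (le_of_eq ?_)
              field_simp; ring
      have h4 : η k * Q ≤ D * η k * Q := by
        gcongr; exact le_mul_of_one_le_left hk0.le hD1
      calc ∫ ω in B, W (k + 1) ω ∂μ
          = (∫ ω in B, ‖U k ω + V k ω‖ ^ p ∂μ) / (l * η (k + 1)) ^ p := by
            rw [← integral_div, hW]; simp only [h.succ]
        _ ≤ (∫ ω in B, ‖U k ω‖ ^ p ∂μ + p ^ 2 * (a ^ (p / 2 - 1) * v k +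
            a ^ (p / 2 - 1) * v k)) / (l * η (k + 1)) ^ p := by gcongr
        _ ≤ _ := by rw [add_div]; linarith
  have hfin := measureReal_exists_one_le_le hWm hW0 hWi n key
  have hz : ∫ ω, W 0 ω ∂μ = 0 := by
    simp only [hW, h.zero]
    simp [Real.zero_rpow hp0.ne']
  simp only [hW1] at hfin
  rw [hz, zero_add, ← Finset.sum_mul, ← Finset.mul_sum] at hfin
  exact hfin

end Recursion

/-! ### Consequences of slowly decaying step sizes -/

section StepSizes

variable {η : ℕ → ℝ}

/-- The relative decrease of `η` is `o(η)`, so it eventually uses at most half of the contraction `c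
* η t`; the other half absorbs the noise. -/
theorem SlowStepSize.exists_forall_ge (hη : SlowStepSize η) {c h : ℝ} (hc : 0 < c) (hh : 0 < h) :
    ∃ s, ∀ t, s ≤ t → η t ≤ h ∧ c * η t ≤ 1 ∧ (1 - c / 2 * η t) * η t ≤ η (t + 1) ∧
      η t ≤ 2 * η (t + 1) := by
  have h1 := hη.tendsto_zero.eventually_le_const (show (0 : ℝ) < min h (1 / c) by positivity)
  have h2 := hη.diff_littleO.def (half_pos hc)
  obtain ⟨s, hs⟩ := eventually_atTop.1 (h1.and h2)
  refine ⟨s, fun t ht => ?_⟩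
  obtain ⟨h3, h4⟩ := hs t ht
  have h0 := hη.pos t
  have h5 : c * η t ≤ 1 := by
    have := h3.trans (min_le_right _ _)
    rw [le_div_iff₀ hc] at this
    linarith
  have h6 : (1 - c / 2 * η t) * η t ≤ η (t + 1) := by
    rw [Real.norm_of_nonneg h0.le, Real.norm_of_nonneg
      (div_nonneg (sub_nonneg.2 (hη.antitone (Nat.le_succ t))) h0.le), div_le_iff₀ h0] at h4
    linarith
  exact ⟨h3.trans (min_le_left _ _), h5, h6, by nlinarith⟩

theorem SlowStepSize.mul_le_two_mul (hη : SlowStepSize η) {T : ℕ} (hT : 1 ≤ T) :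
    (T : ℝ) * η T ≤ 2 * (T * η (T + 1)) := by
  have h1 := hη.mul_monotone (Nat.le_succ T)
  simp only [Nat.succ_eq_add_one, Nat.cast_add, Nat.cast_one] at h1
  have h2 : (1 : ℝ) ≤ T := by exact_mod_cast hT
  nlinarith [hη.pos (T + 1)]

theorem SlowStepSize.exists_sum_le (hη : SlowStepSize η) :
    ∃ C : ℝ, ∀ T : ℕ, 1 ≤ T → ∑ t ∈ Finset.range (T + 1), η t ≤ C * (T * η T) := by
  obtain ⟨C, hC⟩ := hη.sum_le
  refine ⟨C, fun T hT => ?_⟩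
  have h2 : (1 : ℝ) ≤ T := by exact_mod_cast hT
  have := hη.pos T
  exact (div_le_iff₀ (by positivity)).1 (hC T hT)

/-- The solution of `b 0 = 0`, `b (t + 1) = ρ t ^ 2 * b t + 2 * v t`. -/
noncomputable def momentSeq (ρ v : ℕ → ℝ) : ℕ → ℝ
  | 0 => 0
  | t + 1 => ρ t ^ 2 * momentSeq ρ v t + 2 * v t

/-- The bound `K * η t` propagates past `s` once `4 * a ≤ K * c`; the finitely many earlier times
only enlarge `K`. -/
theorem exists_momentSeq_le {ρ : ℕ → ℝ} (hη0 : ∀ t, 0 < η t) {c a K₀ : ℝ} (hc : 0 < c)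
    {s : ℕ} (hρ : ∀ t, s ≤ t → ρ t ^ 2 ≤ 1 - c * η t)
    (hη : ∀ t, s ≤ t → (1 - c / 2 * η t) * η t ≤ η (t + 1)) :
    ∃ K, K₀ ≤ K ∧ ∀ t, momentSeq ρ (fun t => a * η t ^ 2) t ≤ K * η t := by
  set b := momentSeq ρ (fun t => a * η t ^ 2) with hb
  obtain ⟨K₁, hK₁⟩ : ∃ K₁, ∀ t ≤ s, b t / η t ≤ K₁ := by
    obtain ⟨K₁, h⟩ := ((Set.finite_Iic s).image fun t => b t / η t).bddAbove
    exact ⟨K₁, fun t ht => h ⟨t, ht, rfl⟩⟩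
  set K := max (max K₀ 0) (max K₁ (4 * a / c)) with hK
  have hK0 : 0 ≤ K := (le_max_right _ _).trans (le_max_left _ _)
  have hKa : 4 * a ≤ K * c := by
    rw [← div_le_iff₀ hc]; exact (le_max_right _ _).trans (le_max_right _ _)
  refine ⟨K, (le_max_left _ _).trans (le_max_left _ _), fun t => ?_⟩
  rcases le_total t s with hts | hts
  · rw [← div_le_iff₀ (hη0 t)]
    exact (hK₁ t hts).trans ((le_max_left _ _).trans (le_max_right _ _))
  · induction t, hts using Nat.le_induction with
    | base =>
      rw [← div_le_iff₀ (hη0 s)]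
      exact (hK₁ s le_rfl).trans ((le_max_left _ _).trans (le_max_right _ _))
    | succ t ht ih =>
      have h0 := hη0 t
      have h1 := hρ t ht
      calc b (t + 1) = ρ t ^ 2 * b t + 2 * (a * η t ^ 2) := rfl
        _ ≤ ρ t ^ 2 * (K * η t) + 2 * (a * η t ^ 2) := by gcongr
        _ ≤ (1 - c * η t) * (K * η t) + 2 * (a * η t ^ 2) := by gcongr
        _ = K * ((1 - c / 2 * η t) * η t) + (4 * a - K * c) / 2 * η t ^ 2 := by ring
        _ ≤ K * ((1 - c / 2 * η t) * η t) := by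
          have : (4 * a - K * c) / 2 * η t ^ 2 ≤ 0 :=
            mul_nonpos_of_nonpos_of_nonneg (by linarith) (by positivity)
          linarith
        _ ≤ K * η (t + 1) := by gcongr; exact hη t ht

end StepSizes

/-! ### Moments of the noise -/

section NoiseMoments

variable {Ω : Type*} {mΩ : MeasurableSpace Ω} {μ : Measure Ω} [IsProbabilityMeasure μ] {d : ℕ}
  {H : Type*} [NormedAddCommGroup H] [NormedSpace ℝ H]

/-- `L^p` norms increase with `p` on a probability space, so one bound `C * M` serves every `p' ≤
p`. -/
theorem memLp_and_integral_le_of_normMoment_le {N : Seminorm ℝ (Fin d → ℝ)} {p p' : ℝ}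
    (hp' : 1 ≤ p') (hpp' : p' ≤ p) {X : Ω → Fin d → ℝ} (hX : AEStronglyMeasurable X μ)
    (L : (Fin d → ℝ) →L[ℝ] H) {C : ℝ} (hC : 0 ≤ C) (hL : ∀ x, ‖L x‖ ≤ C * N x) {M : ℝ≥0}
    (hM : normMoment μ N p X ^ (1 / p) ≤ M) :
    MemLp (fun ω => L (X ω)) (ENNReal.ofReal p') μ ∧
      ∫ ω, ‖L (X ω)‖ ^ p' ∂μ ≤ (C * M) ^ p' := by
  have hp0 : 0 < p := by linarith
  have hp'0 : 0 < p' := by linarith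
  have hLX : AEStronglyMeasurable (fun ω => L (X ω)) μ :=
    L.continuous.comp_aestronglyMeasurable hX
  have h1 : eLpNorm (fun ω => L (X ω)) (ENNReal.ofReal p) μ ≤ ENNReal.ofReal (C * M) := by
    rw [eLpNorm_eq_lintegral_rpow_enorm_toReal (by simpa using hp0) ENNReal.ofReal_ne_top,
      ENNReal.toReal_ofReal hp0.le]
    calc (∫⁻ ω, ‖L (X ω)‖ₑ ^ p ∂μ) ^ (1 / p)
        ≤ (∫⁻ ω, ENNReal.ofReal C ^ p * ENNReal.ofReal (N (X ω)) ^ p ∂μ) ^ (1 / p) := by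
          gcongr with ω
          rw [← ENNReal.mul_rpow_of_nonneg _ _ hp0.le, ← ENNReal.ofReal_mul hC,
            ← ofReal_norm]
          gcongr
          exact hL _
      _ = ENNReal.ofReal C * normMoment μ N p X ^ (1 / p) := by
          rw [lintegral_const_mul' _ _ (ENNReal.rpow_ne_top_of_nonneg hp0.le
            ENNReal.ofReal_ne_top), ENNReal.mul_rpow_of_nonneg _ _ (by positivity),
            ← ENNReal.rpow_mul, mul_one_div_cancel hp0.ne', ENNReal.rpow_one]
          rfl
      _ ≤ ENNReal.ofReal C * M := by gcongr
      _ = _ := by rw [ENNReal.ofReal_mul hC, ENNReal.ofReal_coe_nnreal]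
  have h2 : eLpNorm (fun ω => L (X ω)) (ENNReal.ofReal p') μ ≤ ENNReal.ofReal (C * M) :=
    (eLpNorm_le_eLpNorm_of_exponent_le (ENNReal.ofReal_le_ofReal hpp') hLX).trans h1
  have hmem : MemLp (fun ω => L (X ω)) (ENNReal.ofReal p') μ :=
    ⟨hLX, h2.trans_lt ENNReal.ofReal_lt_top⟩
  refine ⟨hmem, ?_⟩
  rw [hmem.eLpNorm_eq_integral_rpow_norm (by simpa using hp'0) ENNReal.ofReal_ne_top,
    ENNReal.toReal_ofReal hp'0.le, ENNReal.ofReal_le_ofReal_iff (by positivity)] at h2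
  have h3 : 0 ≤ ∫ ω, ‖L (X ω)‖ ^ p' ∂μ := integral_nonneg fun ω => by positivity
  rwa [Real.rpow_inv_le_iff_of_pos h3 (by positivity) hp'0] at h2

end NoiseMoments

/-! ### The explicit solution of the recursion -/

section ExplicitFormula

variable {d : ℕ}

theorem stepProd_self (G : Matrix (Fin d) (Fin d) ℝ) (η : ℕ → ℝ) (t : ℕ) :
    stepProd G η t t = 1 := by
  simp [stepProd]

theorem stepProd_succ (G : Matrix (Fin d) (Fin d) ℝ) (η : ℕ → ℝ) {j t : ℕ} (hj : j ≤ t) :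
    stepProd G η j (t + 1) = (1 - η (t + 1) • G) * stepProd G η j t := by
  have hcomm : Commute (1 - η (t + 1) • G) (stepProd G η j t) := by
    refine Commute.list_prod_right _ _ fun x hx => ?_
    obtain ⟨i, _, rfl⟩ := List.mem_map.1 hx
    have h1 : Commute (η (t + 1) • G) (η i • G) :=
      ((Commute.refl G).smul_left _).smul_right _
    exact ((Commute.one_left _).sub_left ((Commute.one_right _).sub_right h1))
  rw [hcomm.eq]
  unfold stepProd
  rw [show t + 1 - j = (t - j) + 1 by omega, List.range'_concat, List.map_append,
    List.prod_append]
  simp [show j + 1 + (t - j) = t + 1 by omega]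

theorem ySeq_succ_eq_sum {Ω : Type*} (G : Matrix (Fin d) (Fin d) ℝ) (η : ℕ → ℝ)
    (ε : ℕ → Ω → Fin d → ℝ) (t : ℕ) (ω : Ω) :
    ySeq G η ε (t + 1) ω =
      ∑ j ∈ Finset.range (t + 1), (stepProd G η j t).mulVec (η j • ε j ω) := by
  induction t with
  | zero => simp [ySeq, stepProd_self]
  | succ t ih =>
    rw [ySeq, ih, Finset.sum_range_succ _ (t + 1), stepProd_self, Matrix.one_mulVec,
      Matrix.mulVec_sum]
    congr 1
    refine Finset.sum_congr rfl fun j hj => ?_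
    rw [stepProd_succ G η (by simpa [Nat.lt_succ_iff] using hj), Matrix.mulVec_mulVec]

end ExplicitFormula

/-! ### The tail bound for the normalized supremum -/

section TailBound

variable {d : ℕ}

theorem yBarSup_nonneg {Ω : Type*} (N : Seminorm ℝ (Fin d → ℝ)) (G : Matrix (Fin d) (Fin d) ℝ)
    (η : ℕ → ℝ) (ε : ℕ → Ω → Fin d → ℝ) (T : ℕ) (ω : Ω) : 0 ≤ yBarSup N G η ε T ω :=
  Real.iSup_nonneg fun _ => apply_nonneg _ _

/-- The supremum runs over finitely many indices, so a maximal one exists; `r = 1` reaches index `T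
+ 1`. -/
theorem exists_le_of_le_yBarSup {Ω : Type*} {N : Seminorm ℝ (Fin d → ℝ)}
    {G : Matrix (Fin d) (Fin d) ℝ} {η : ℕ → ℝ} (hη : ∀ t, 0 < η t) {ε : ℕ → Ω → Fin d → ℝ}
    {T : ℕ} (hT : 1 ≤ T) {ω : Ω} {δ : ℝ} (h : δ ≤ yBarSup N G η ε T ω) :
    ∃ r ≤ T + 1, δ * (Real.sqrt T * η r) ≤ N (ySeq G η ε r ω) := by
  by_contra! hc
  have hT0 : (0 : ℝ) < T := by exact_mod_cast hT
  have hpos : ∀ r, 0 < Real.sqrt T * η r := fun r => mul_pos (Real.sqrt_pos.2 hT0) (hη r)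
  obtain ⟨r₀, hr₀, hmax⟩ := (Finset.range (T + 2)).exists_max_image
    (fun r => (Real.sqrt T * η r)⁻¹ * N (ySeq G η ε r ω)) ⟨0, by simp⟩
  have h1 : yBarSup N G η ε T ω ≤ (Real.sqrt T * η r₀)⁻¹ * N (ySeq G η ε r₀ ω) := by
    have : Nonempty (Set.Icc (0 : ℝ) 1) := ⟨⟨0, by simp⟩⟩
    refine ciSup_le fun r => ?_
    rw [yBar, map_smul_eq_mul, Real.norm_of_nonneg (inv_nonneg.2 (hpos _).le)]
    refine hmax _ (Finset.mem_range.2 ?_)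
    rw [Nat.floor_lt (mul_nonneg (by positivity) r.2.1)]
    push_cast
    nlinarith [r.2.2]
  have h2 := hc r₀ (by have := Finset.mem_range.1 hr₀; omega)
  have h3 : (Real.sqrt T * η r₀)⁻¹ * N (ySeq G η ε r₀ ω) < δ := by
    rw [← div_eq_inv_mul, div_lt_iff₀ (hpos r₀)]
    exact h2
  linarith

/-- The information available before the noise at time `t` is revealed. -/
abbrev pastSigma {Ω : Type*} {mΩ : MeasurableSpace Ω} (ℱ : Filtration ℕ mΩ) :
    ℕ → MeasurableSpace Ω
  | 0 => ⊥
  | t + 1 => ℱ t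

theorem pastSigma_le {Ω : Type*} {mΩ : MeasurableSpace Ω} (ℱ : Filtration ℕ mΩ) :
    ∀ t, pastSigma ℱ t ≤ mΩ
  | 0 => bot_le
  | t + 1 => ℱ.le t

theorem pastSigma_mono {Ω : Type*} {mΩ : MeasurableSpace Ω} (ℱ : Filtration ℕ mΩ) :
    Monotone (pastSigma ℱ) :=
  monotone_nat_of_le_succ fun
    | 0 => bot_le
    | t + 1 => ℱ.mono (Nat.le_succ t)

theorem stronglyMeasurable_ySeq {Ω : Type*} {mΩ : MeasurableSpace Ω} {μ : Measure Ω}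
    {ℱ : Filtration ℕ mΩ} {ε : ℕ → Ω → Fin d → ℝ} (hε : IsMartingaleDifference μ ℱ ε)
    (G : Matrix (Fin d) (Fin d) ℝ) (η : ℕ → ℝ) (t : ℕ) :
    StronglyMeasurable[pastSigma ℱ t] (ySeq G η ε t) := by
  induction t with
  | zero => exact stronglyMeasurable_const
  | succ t ih =>
    have h1 : StronglyMeasurable[pastSigma ℱ (t + 1)] (ySeq G η ε t) :=
      ih.mono (pastSigma_mono ℱ (Nat.le_succ t))
    have h2 : Continuous fun x : Fin d → ℝ => (1 - η t • G).mulVec x :=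
      Continuous.matrix_mulVec continuous_const continuous_id
    exact (h2.comp_stronglyMeasurable h1).add ((hε.adapted t).const_smul (η t))

/-- The noise process, embedded in a Hilbert space, drives a perturbed contraction. -/
theorem IsMartingaleDifference.isPerturbedContraction {Ω : Type*} {mΩ : MeasurableSpace Ω}
    {μ : Measure Ω} [IsProbabilityMeasure μ] {ℱ : Filtration ℕ mΩ} {ε : ℕ → Ω → Fin d → ℝ}
    (hε : IsMartingaleDifference μ ℱ ε) {N : Seminorm ℝ (Fin d → ℝ)}
    {G : Matrix (Fin d) (Fin d) ℝ} {η ρ : ℕ → ℝ} (hη : ∀ t, 0 < η t) (hρ : ∀ t, 0 ≤ ρ t)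
    {H : Type*} [NormedAddCommGroup H] [InnerProductSpace ℝ H] [CompleteSpace H]
    (L : (Fin d → ℝ) →L[ℝ] H) (hLρ : ∀ t x, ‖L ((1 - η t • G).mulVec x)‖ ≤ ρ t * ‖L x‖)
    {C : ℝ} (hC : 0 ≤ C) (hL : ∀ x, ‖L x‖ ≤ C * N x) {p p' : ℝ} (hp' : 1 ≤ p') (hpp' : p' ≤ p)
    {M : ℝ≥0} (hM : ∀ t, normMoment μ N p (ε t) ^ (1 / p) ≤ M) :
    IsPerturbedContraction μ p' (pastSigma ℱ) (fun t ω => L (ySeq G η ε t ω))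
      (fun t ω => L ((1 - η t • G).mulVec (ySeq G η ε t ω))) (fun t ω => η t • L (ε t ω)) ρ
      (fun t => (C * M) ^ 2 * η t ^ 2) := by
  have hεm : ∀ t, AEStronglyMeasurable (ε t) μ := fun t => (hε.integrable t).1
  have hmom := fun t => memLp_and_integral_le_of_normMoment_le hp' hpp' (hεm t) L hC hL (hM t)
  refine ⟨pastSigma_le ℱ, pastSigma_mono ℱ, ?_, ?_, ?_, ?_, fun t ω => hLρ t _, hρ, ?_, ?_, ?_,
    ?_⟩
  · ext ω : 1
    exact map_zero L
  · intro t
    ext ω : 1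
    simp only [ySeq, map_add, map_smul]
  · exact fun t => L.continuous.comp_stronglyMeasurable (stronglyMeasurable_ySeq hε G η t)
  · exact fun t => (L.continuous.comp (Continuous.matrix_mulVec continuous_const
      continuous_id)).comp_stronglyMeasurable (stronglyMeasurable_ySeq hε G η t)
  · exact fun t => (hmom t).1.const_smul (η t)
  · exact fun t => by positivity
  · intro t
    have h0 := (hη t).le
    have hCM : 0 ≤ C * M := by positivity
    calc ∫ ω, ‖η t • L (ε t ω)‖ ^ p' ∂μ = ∫ ω, η t ^ p' * ‖L (ε t ω)‖ ^ p' ∂μ := by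
          congr 1; ext ω
          rw [norm_smul, Real.norm_of_nonneg h0, Real.mul_rpow h0 (norm_nonneg _)]
      _ = η t ^ p' * ∫ ω, ‖L (ε t ω)‖ ^ p' ∂μ := integral_const_mul _ _
      _ ≤ η t ^ p' * (C * M) ^ p' := by gcongr; exact (hmom t).2
      _ = _ := by
          rw [← mul_pow, ← Real.rpow_natCast_mul (by positivity), mul_comm (C * (M : ℝ)),
            Real.mul_rpow h0 hCM]
          congr 2 <;> push_cast <;> ring
  -- `ε 0` is not assumed centred, but `y 0 = 0`.
  · rintro (_ | t)
    · left
      ext ω : 1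
      simp [ySeq]
    · right
      have h1 := (η (t + 1) • L).comp_condExp_comm (m := ℱ t) (hε.integrable (t + 1))
      have h2 : (fun ω => η (t + 1) • L (ε (t + 1) ω)) = (η (t + 1) • L) ∘ ε (t + 1) := rfl
      rw [h2]
      filter_upwards [h1, hε.condExp_eq_zero t] with ω h3 h4
      change (μ[(η (t + 1) • L) ∘ ε (t + 1) | ℱ t]) ω = _
      rw [← h3]
      simp [h4]

/-- `A` is chosen before `p` and `p'`: the constants `E` and `F` are at least one, so the prefactor
satisfies `E ≤ E ^ p'` and enters the base of the power. -/
theorem exists_tail_bound (N : Seminorm ℝ (Fin d → ℝ)) (hN : ∀ v, N v = 0 → v = 0)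
    (G : Matrix (Fin d) (Fin d) ℝ) (hG : PosRealPartEigenvalues G)
    (η : ℕ → ℝ) (hη : SlowStepSize η) (M : ℝ≥0) :
    ∃ A : ℝ, 1 ≤ A ∧ ∀ (Ω : Type*) (mΩ : MeasurableSpace Ω) (μ : Measure Ω)
      (_ : IsProbabilityMeasure μ) (ℱ : Filtration ℕ mΩ) (ε : ℕ → Ω → Fin d → ℝ),
      IsMartingaleDifference μ ℱ ε → ∀ p p' : ℝ, 2 < p' → p' ≤ p →
        (∀ t, normMoment μ N p (ε t) ^ (1 / p) ≤ M) → ∀ T : ℕ, 1 ≤ T → ∀ δ : ℝ, 0 < δ →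
          μ.real {ω | δ ≤ yBarSup N G η ε T ω} ≤
            (A * p' / δ) ^ p' * ((T : ℝ) * η T) ^ (1 - p' / 2) := by
  obtain ⟨n, Φ, hΦ, c, hc, h, hh, R, hR, hcontr, hbdd⟩ := exists_lyapunov_embedding G hG
  obtain ⟨C, hC1, hNΦ, hΦN⟩ := exists_norm_equiv N hN Φ hΦ
  obtain ⟨s, hs⟩ := hη.exists_forall_ge hc hh
  obtain ⟨S, hS⟩ := hη.exists_sum_le
  set L := Φ.toContinuousLinearMap with hL
  have hC0 : 0 ≤ C := by linarith
  set ρ : ℕ → ℝ := fun t => if t < s then R else 1 - c * η t with hρdef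
  have hρs : ∀ t, s ≤ t → ρ t = 1 - c * η t := fun t ht => if_neg (not_lt.2 ht)
  have hρ0 : ∀ t, 0 ≤ ρ t := fun t => by
    by_cases ht : t < s
    · simp only [hρdef, ht, if_true]; linarith
    · rw [hρs t (not_lt.1 ht)]; linarith [(hs t (not_lt.1 ht)).2.1]
  have hρ1 : ∀ t, s ≤ t → ρ t ≤ 1 := fun t ht => by
    rw [hρs t ht]
    have := mul_pos hc (hη.pos t)
    linarith
  have hLρ : ∀ t x, ‖L ((1 - η t • G).mulVec x)‖ ≤ ρ t * ‖L x‖ := fun t x => by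
    by_cases ht : t < s
    · simp only [hρdef, ht, if_true]
      exact hbdd _ (hη.pos t).le (hη.le_one t) x
    · rw [hρs t (not_lt.1 ht)]
      exact hcontr _ (hη.pos t).le (hs t (not_lt.1 ht)).1 x
  obtain ⟨K, hK0, hK⟩ := exists_momentSeq_le (ρ := ρ) (a := (C * M) ^ 2)
    (K₀ := 2 * (C * M) ^ 2) hη.pos hc (s := s)
    (fun t ht => by
      have h1 := hρ0 t
      have h2 := hρ1 t ht
      rw [hρs t ht] at h1 h2 ⊢
      nlinarith)
    (fun t ht => (hs t ht).2.2.1)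
  have hK0' : 0 ≤ K := le_trans (by positivity) hK0
  set D := max 1 (1 / η s) with hD
  have hD1 : 1 ≤ D := le_max_left _ _
  have hDη : ∀ t, t < s → 1 ≤ D * η t := fun t ht => by
    calc (1 : ℝ) = 1 / η s * η s := by rw [one_div_mul_cancel (hη.pos s).ne']
      _ ≤ D * η t := by
        have := hη.pos s
        gcongr
        · exact le_max_right _ _
        · exact hη.antitone ht.le
  set E := max 1 (D * S) with hE
  have hE1 : 1 ≤ E := le_max_left _ _
  -- The `8` is the `4` of the maximal bound times the `2` lost in passing from `η (T + 1)` to `η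
  -- T`.
  set F := 1 + 8 * K * C ^ 2 with hF
  have hF1 : 1 ≤ F := by
    have : 0 ≤ 8 * K * C ^ 2 := by positivity
    linarith
  refine ⟨E * F, one_le_mul_of_one_le_of_one_le hE1 hF1, ?_⟩
  intro Ω mΩ μ _ ℱ ε hε p p' hp' hpp' hM T hT δ hδ
  have hpc := hε.isPerturbedContraction hη.pos hρ0 L hLρ hC0 hΦN (by linarith) hpp' hM
  have hT0 : (0 : ℝ) < T := by exact_mod_cast hT
  have hηT := hη.pos T
  have hηT1 := hη.pos (T + 1)
  have hX : 0 < (T : ℝ) * η T := by positivity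
  have hl : 0 < δ * Real.sqrt T / C := by positivity
  have hmain := hpc.measureReal_exists_le_norm_le hp' hη.pos hη.antitone
    (b := momentSeq ρ (fun t => (C * M) ^ 2 * η t ^ 2)) le_rfl (fun t => rfl) hK
    (fun t => by
      rw [← mul_assoc]
      gcongr) hρ1
    (fun t ht => by
      rw [hρs t ht]
      refine le_trans ?_ (hs t ht).2.2.1
      have := hη.pos t
      have : 0 < c * η t := by positivity
      gcongr ?_ * _
      linarith)
    (fun t ht => (hs t ht).2.2.2) hD1 hDη hl (T + 1)
  have hsub : {ω | δ ≤ yBarSup N G η ε T ω} ⊆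
      {ω | ∃ r ≤ T + 1, δ * Real.sqrt T / C * η r ≤ ‖L (ySeq G η ε r ω)‖} := by
    intro ω hω
    obtain ⟨r, hr, h1⟩ := exists_le_of_le_yBarSup hη.pos hT hω
    refine ⟨r, hr, ?_⟩
    have h2 : δ * (Real.sqrt T * η r) ≤ C * ‖L (ySeq G η ε r ω)‖ := h1.trans (hNΦ _)
    rw [div_mul_eq_mul_div, div_le_iff₀ (by linarith)]
    linarith
  refine (measureReal_mono hsub).trans (hmain.trans ?_)
  set X := (T : ℝ) * η T with hXdef
  have hfrac : 4 * (p' ^ 2 * K) / ((δ * Real.sqrt T / C) ^ 2 * η (T + 1)) ≤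
      (F * p' / δ) ^ 2 / X := by
    rw [div_pow, mul_pow, Real.sq_sqrt hT0.le]
    calc 4 * (p' ^ 2 * K) / (δ ^ 2 * T / C ^ 2 * η (T + 1))
        = 8 * K * C ^ 2 * (p' / δ) ^ 2 / (2 * (T * η (T + 1))) := by field_simp; ring
      _ ≤ F * (p' / δ) ^ 2 / X := by
          gcongr
          · linarith
          · exact hη.mul_le_two_mul hT
      _ ≤ F ^ 2 * (p' / δ) ^ 2 / X := by
          gcongr
          nlinarith
      _ = _ := by ring
  have hsum : D * ∑ k ∈ Finset.range (T + 1), η k ≤ E * X := by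
    calc D * ∑ k ∈ Finset.range (T + 1), η k ≤ D * (S * X) := by gcongr; exact hS T hT
      _ = (D * S) * X := by ring
      _ ≤ E * X := by gcongr; exact le_max_right _ _
  have hEp : E ≤ E ^ p' := by
    simpa using Real.rpow_le_rpow_of_exponent_le hE1 (show (1 : ℝ) ≤ p' by linarith)
  calc D * (∑ k ∈ Finset.range (T + 1), η k) *
        (4 * (p' ^ 2 * K) / ((δ * Real.sqrt T / C) ^ 2 * η (T + 1))) ^ (p' / 2)
      ≤ E ^ p' * X * ((F * p' / δ) ^ 2 / X) ^ (p' / 2) := by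
        refine mul_le_mul (hsum.trans (by gcongr)) (Real.rpow_le_rpow (by positivity) hfrac
          (by linarith)) (by positivity) (by positivity)
    _ = E ^ p' * X * ((F * p' / δ) ^ p' / X ^ (p' / 2)) := by
        rw [Real.div_rpow (by positivity) hX.le, ← Real.rpow_natCast_mul (by positivity)]
        congr 4; push_cast; ring
    _ = (E * F * p' / δ) ^ p' * X ^ (1 - p' / 2) := by
        rw [Real.rpow_sub hX, Real.rpow_one,
          show E * F * p' / δ = E * (F * p' / δ) by ring,
          Real.mul_rpow (x := E) (y := F * p' / δ) (by positivity) (by positivity)]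
        ring

end TailBound

/-! ### From the tail bound to the Ky Fan rate and the main theorem -/

theorem kyFan_le {Ω : Type*} {mΩ : MeasurableSpace Ω} (μ : Measure Ω) (X : Ω → ℝ) {δ : ℝ}
    (hδ : 0 ≤ δ) (h : μ.real {ω | δ ≤ X ω} ≤ δ) : kyFan μ X ≤ δ := by
  refine (ciInf_le ⟨0, ?_⟩ (⟨δ, hδ⟩ : Set.Ici (0 : ℝ))).trans (max_le le_rfl h)
  rintro _ ⟨x, rfl⟩
  exact le_max_of_le_left x.2

theorem mainTheorem10 {d : ℕ}
    -- an arbitrary norm on `ℝ^d`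
    (N : Seminorm ℝ (Fin d → ℝ)) (hN : ∀ v, N v = 0 → v = 0)
    (G : Matrix (Fin d) (Fin d) ℝ) (hG : PosRealPartEigenvalues G)
    (η : ℕ → ℝ) (hη : SlowStepSize η) :
    -- the explicit formula for `y`, and uniform convergence to zero in probability
    (∀ (Ω : Type*) (mΩ : MeasurableSpace Ω) (μ : Measure Ω) (_ : IsProbabilityMeasure μ)
        (ℱ : Filtration ℕ mΩ) (ε : ℕ → Ω → Fin d → ℝ), IsMartingaleDifference μ ℱ ε →
        ∀ p : ℝ, 2 < p → (⨆ t, normMoment μ N p (ε t)) < ∞ →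
          (∀ t ω, ySeq G η ε (t + 1) ω =
            ∑ j ∈ Finset.range (t + 1), (stepProd G η j t).mulVec (η j • ε j ω)) ∧
          TendstoInMeasure μ (fun T : ℕ => yBarSup N G η ε T) atTop (fun _ => 0)) ∧
    -- the rate for `η t = t ^ (-α)`; the constant `C` depends on `ε` and `p` only through a
    -- bound `M` on the `L^p` norms, and not on `p'` or `T`
    (∀ α : ℝ, 1 / 2 < α → α < 1 → (∀ t : ℕ, 1 ≤ t → η t = (t : ℝ) ^ (-α)) →
      ∀ M : ℝ≥0, ∃ C : ℝ,
        ∀ (Ω : Type*) (mΩ : MeasurableSpace Ω) (μ : Measure Ω) (_ : IsProbabilityMeasure μ)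
          (ℱ : Filtration ℕ mΩ) (ε : ℕ → Ω → Fin d → ℝ), IsMartingaleDifference μ ℱ ε →
          ∀ p : ℝ, 2 < p → (⨆ t, normMoment μ N p (ε t) ^ (1 / p)) ≤ M →
            ∀ p' : ℝ, 2 ≤ p' → p' ≤ p → ∀ T : ℕ, 1 ≤ T →
              kyFan μ (yBarSup N G η ε T) ≤
                C * (p' * (T : ℝ) ^ (-((1 - α) * ((p' - 2) / (2 * (p' + 1))))))) := by
  refine ⟨?_, ?_⟩
  · intro Ω mΩ μ _ ℱ ε hε p hp hmom
    refine ⟨ySeq_succ_eq_sum G η ε, ?_⟩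
    set m := ⨆ t, normMoment μ N p (ε t) with hm
    have hmtop : m ^ (1 / p) ≠ ∞ := ENNReal.rpow_ne_top_of_nonneg (by positivity) hmom.ne
    obtain ⟨A, hA1, hA⟩ := exists_tail_bound N hN G hG η hη (m ^ (1 / p)).toNNReal
    have hbound := hA Ω mΩ μ inferInstance ℱ ε hε p p hp le_rfl fun t => by
      rw [ENNReal.coe_toNNReal hmtop]
      exact ENNReal.rpow_le_rpow (le_iSup (fun t => normMoment μ N p (ε t)) t) (by positivity)
    rw [tendstoInMeasure_iff_measureReal_norm]
    intro δ hδ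
    have hlim : Tendsto (fun T : ℕ => (A * p / δ) ^ p * ((T : ℝ) * η T) ^ (1 - p / 2)) atTop
        (𝓝 0) := by
      have h1 := (tendsto_rpow_neg_atTop (show 0 < p / 2 - 1 by linarith)).comp hη.mul_tendsto
      simpa [Function.comp_def] using h1.const_mul ((A * p / δ) ^ p)
    refine squeeze_zero' (Eventually.of_forall fun T => measureReal_nonneg) ?_ hlim
    filter_upwards [eventually_ge_atTop 1] with T hT
    simpa [abs_of_nonneg (yBarSup_nonneg N G η ε T _)] using hbound T hT δ hδ
  · intro α _ hα1 hηα M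
    obtain ⟨A, hA1, hA⟩ := exists_tail_bound N hN G hG η hη M
    refine ⟨A, ?_⟩
    intro Ω mΩ μ _ ℱ ε hε p hp hmom p' hp'2 hp'p T hT
    have hT1 : (1 : ℝ) ≤ T := by exact_mod_cast hT
    rcases hp'2.eq_or_lt with rfl | hp'2
    -- At `p' = 2` the exponent vanishes and the trivial bound one suffices.
    · refine (kyFan_le μ _ zero_le_one measureReal_le_one).trans ?_
      simp
      linarith
    · have hbound := hA Ω mΩ μ inferInstance ℱ ε hε p p' hp'2 hp'p
        (fun t => (le_iSup (fun t => normMoment μ N p (ε t) ^ (1 / p)) t).trans hmom) T hT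
      set e := (p' - 2) / (2 * (p' + 1)) with he
      have hT0 : (0 : ℝ) < T := by linarith
      have hX : (T : ℝ) * η T = (T : ℝ) ^ (1 - α) := by
        rw [hηα T hT, sub_eq_add_neg, Real.rpow_add hT0, Real.rpow_one]
      have hY0 : 0 < (T : ℝ) ^ (-((1 - α) * e)) := by positivity
      have hAp : 1 ≤ A * p' := by nlinarith
      -- The choice is `δ = A p' T ^ (-(1 - α) e)`, with `e` solving `e p' + 1 - p' / 2 = -e`, so
      -- that the tail bound has the same power of `T` as `δ`; then `A p' ≥ 1` concludes.
      refine kyFan_le μ _ (by positivity) ((hbound _ (by positivity)).trans ?_)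
      have h1 : A * p' / (A * (p' * (T : ℝ) ^ (-((1 - α) * e)))) = (T : ℝ) ^ ((1 - α) * e) := by
        rw [Real.rpow_neg hT0.le]
        field_simp
      rw [h1, hX, ← Real.rpow_mul hT0.le, ← Real.rpow_mul hT0.le, ← Real.rpow_add hT0,
        ← mul_assoc]
      have h2 : (1 - α) * e * p' + (1 - α) * (1 - p' / 2) = -((1 - α) * e) := by
        rw [he]
        field_simp
        ring
      rw [h2]
      exact le_mul_of_one_le_left hY0.le hAp
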